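/- \textbf{Setting.} Let $(\overline M,\overline g)$ be a semi-Riemannian manifold with Levi-Civita connection $\overline\nabla$ and an indefinite almost contact metric structure $(\overline\phi,\xi,\eta)$, i.e. $\overline\phi^2=-I+\eta\otimes\xi$, $\eta(\xi)=1$, $\eta\circ\overline\phi=0$, $\overline\phi\xi=0$, $\overline g(\overline\phi X,\overline\phi Y)=\overline g(X,Y)-\eta(X)\eta(Y)$, $\eta=\overline g(\xi,\cdot)$. Assume it is nearly $\mu$-Sasakian for a constant $\mu\in\mathbb R$: $$(\overline\nabla_X\overline\phi)Y+(\overline\nabla_Y\overline\phi)X=\mu\{2\overline g(X,Y)\xi-\eta(Y)X-\eta(X)Y\}.$$ Let $M$ be an immersed $r$-lightlike submanifold, i.e. $\mathrm{Rad}\,TM=TM\cap TM^\perp$ is a smooth distribution of rank $r>0$. Choose a screen distribution $S(TM)$ with $TM=\mathrm{Rad}\,TM\perp S(TM)$, a screen transversal bundle with $TM^\perp=\mathrm{Rad}\,TM\perp S(TM^\perp)$ (both nondegenerate), and a null bundle $l\mathrm{tr}(TM)$ orthogonal to both, such that every basis $E_1,\dots,E_r$ of $\mathrm{Rad}\,TM$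 at a point has a basis $N_1,\dots,N_r$ of $l\mathrm{tr}(TM)$ with $\overline g(E_a,N_b)=\delta_{ab}$. Put $\mathrm{tr}(TM)=l\mathrm{tr}(TM)\perp S(TM^\perp)$, so that $T\overline M|_M=TM\oplus\mathrm{tr}(TM)$. For $X,Y\in\Gamma(TM)$ and $V\in\Gamma(\mathrm{tr}(TM))$ let $\nabla_XY$ and $h(X,Y)$ be the tangential and transversal components of $\overline\nabla_XY$, let $\nabla^t_XV$ be the transversal component of $\overline\nabla_XV$, and write $\overline\phi X=\phi_1X+\varphi_1X$ with $\phi_1X\in TM$, $\varphi_1X\in\mathrm{tr}(TM)$. Let $M$ be QGCR-lightlike: there are smooth subbundles $D_1,D_2\subset\mathrm{Rad}\,TM$, $D_0\subset S(TM)$, $\mathcal L\subset l\mathrm{tr}(TM)$, $\mathcal S\subset S(TM^\perp)$ with $$\mathrm{Rad}\,TM=D_1\oplus D_2,\quad \overline\phi D_1=D_1,\quad \overline\phi D_2\subset S(TM),\quad S(TM)=\{\overline\phi D_2\oplus\overline D\}\perp D_0,\quad \overline D=\overline\phi\mathcal S\oplus\overline\phi\mathcal L,$$ where $D_0$ is nondegenerate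 and $\overline\phi D_0\subseteq D_0$. Let $M$ be co-screen: $\xi\in\Gamma(S(TM^\perp))$ and $\overline\phi\,\overline D=\mathcal S\perp\mathcal L$. Put $D=\mathrm{Rad}\,TM\perp D_0\perp\overline\phi D_2$, and let $\mathcal G$ be the bundle of all vectors of $\mathrm{tr}(TM)$ orthogonal to $D_2$, to $\mathcal S$ and to $\xi$. \textbf{Theorem.} (a) $\mathrm{tr}(TM)=(\mathcal L\perp\mathcal S)\perp\mathcal G\perp\mathbb R\xi$ at every point, and if $\mathrm{tr}(TM)=(\mathcal L\perp\mathcal S)\perp\mathcal G'\perp\mathbb R\xi$ at a point with $\overline\phi\mathcal G'=\mathcal G'$, then $\mathcal G'=\mathcal G$ there. (b) Let $X\in\Gamma(TM)$, $Y\in\Gamma(D)$ and $p\in M$. If $(\nabla_XY+\nabla_YX)_p\in D_p$, then at $p$ the vector $$h(X,\overline\phi Y)+h(Y,\phi_1X)+\nabla^t_Y\varphi_1X$$ has no component in $\mathcal L\perp\mathcal S$ with respect to the splitting in (a), i.e. it lies in $\mathcal G\perp\mathbb R\xi$. (c) In particular, if $D$ is nearly parallel, i.e. $\nabla_XY+\nabla_YX\in\Gamma(D)$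 for all $X\in\Gamma(TM)$ and $Y\in\Gamma(D)$, then $h(X,\overline\phi Y)+h(Y,\phi_1X)+\nabla^t_Y\varphi_1X$ has no component in $\mathcal L\perp\mathcal S$ for all $X\in\Gamma(TM)$ and $Y\in\Gamma(D)$. -/

import Mathlib

open scoped Manifold ContDiff Topology
open Bundle

noncomputable section

namespace Lightlike

section Ambient

/-! ### Semi-Riemannian and almost contact metric structures -/

variable (E : Type*) [NormedAddCommGroup E] [NormedSpace ℝ E]
  (N : Type*) [TopologicalSpace N] [ChartedSpace E N] [IsManifold 𝓘(ℝ, E) ∞ N]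

/-- A smooth semi-Riemannian metric: a smooth field of nondegenerate symmetric bilinear forms on the
tangent spaces (of any signature). -/
structure SemiRiemannianMetric where
  val : ∀ x : N, TangentSpace 𝓘(ℝ, E) x →L[ℝ] TangentSpace 𝓘(ℝ, E) x →L[ℝ] ℝ
  symm : ∀ x (v w : TangentSpace 𝓘(ℝ, E) x), val x v w = val x w v
  nondegenerate : ∀ x (v : TangentSpace 𝓘(ℝ, E) x), (∀ w, val x v w = 0) → v = 0
  smooth : ContMDiff 𝓘(ℝ, E) (𝓘(ℝ, E).prod 𝓘(ℝ, E →L[ℝ] E →L[ℝ] ℝ)) ∞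
    (fun x : N ↦ TotalSpace.mk' (E →L[ℝ] E →L[ℝ] ℝ)
      (E := fun x : N ↦ TangentSpace 𝓘(ℝ, E) x →L[ℝ] TangentSpace 𝓘(ℝ, E) x →L[ℝ] ℝ) x (val x))

variable {E N}

/-- An indefinite almost contact metric structure `(φ, ξ, η, g)` on a manifold with a
semi-Riemannian metric `g`. -/
structure AlmostContactMetric (g : SemiRiemannianMetric E N) where
  φ : ∀ x : N, TangentSpace 𝓘(ℝ, E) x →L[ℝ] TangentSpace 𝓘(ℝ, E) x
  ξ : ∀ x : N, TangentSpace 𝓘(ℝ, E) x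
  η : ∀ x : N, TangentSpace 𝓘(ℝ, E) x →L[ℝ] ℝ
  smooth_φ : ContMDiff 𝓘(ℝ, E) (𝓘(ℝ, E).prod 𝓘(ℝ, E →L[ℝ] E)) ∞
    (fun x : N ↦ TotalSpace.mk' (E →L[ℝ] E)
      (E := fun x : N ↦ TangentSpace 𝓘(ℝ, E) x →L[ℝ] TangentSpace 𝓘(ℝ, E) x) x (φ x))
  smooth_ξ : ContMDiff 𝓘(ℝ, E) 𝓘(ℝ, E).tangent ∞
    (fun x : N ↦ (⟨x, ξ x⟩ : TangentBundle 𝓘(ℝ, E) N))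
  smooth_η : ContMDiff 𝓘(ℝ, E) (𝓘(ℝ, E).prod 𝓘(ℝ, E →L[ℝ] ℝ)) ∞
    (fun x : N ↦ TotalSpace.mk' (E →L[ℝ] ℝ)
      (E := fun x : N ↦ TangentSpace 𝓘(ℝ, E) x →L[ℝ] ℝ) x (η x))
  φ_φ : ∀ x v, φ x (φ x v) = -v + η x v • ξ x
  η_ξ : ∀ x, η x (ξ x) = 1
  η_φ : ∀ x v, η x (φ x v) = 0
  φ_ξ : ∀ x, φ x (ξ x) = 0
  metric_φ : ∀ x v w, g.val x (φ x v) (φ x w) = g.val x v w - η x v * η x w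
  η_eq : ∀ x v, η x v = g.val x (ξ x) v

/-- `nabla` is the Levi-Civita connection of `g`: torsion-free and metric. Here `nabla Y x v` is
`(∇_v Y)(x)`. -/
structure IsLeviCivita [FiniteDimensional ℝ E] (g : SemiRiemannianMetric E N)
    (nabla : CovariantDerivative 𝓘(ℝ, E) E (TangentSpace 𝓘(ℝ, E) : N → Type _)) : Prop where
  torsion_free : ∀ (X Y : ∀ x : N, TangentSpace 𝓘(ℝ, E) x) (x : N),
    MDifferentiableAt 𝓘(ℝ, E) 𝓘(ℝ, E).tangent
      (fun y ↦ (⟨y, X y⟩ : TangentBundle 𝓘(ℝ, E) N)) x →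
    MDifferentiableAt 𝓘(ℝ, E) 𝓘(ℝ, E).tangent
      (fun y ↦ (⟨y, Y y⟩ : TangentBundle 𝓘(ℝ, E) N)) x →
    nabla Y x (X x) - nabla X x (Y x) = VectorField.mlieBracket 𝓘(ℝ, E) X Y x
  metric : ∀ (Y Z : ∀ x : N, TangentSpace 𝓘(ℝ, E) x) (x : N) (v : TangentSpace 𝓘(ℝ, E) x),
    MDifferentiableAt 𝓘(ℝ, E) 𝓘(ℝ, E).tangent
      (fun y ↦ (⟨y, Y y⟩ : TangentBundle 𝓘(ℝ, E) N)) x →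
    MDifferentiableAt 𝓘(ℝ, E) 𝓘(ℝ, E).tangent
      (fun y ↦ (⟨y, Z y⟩ : TangentBundle 𝓘(ℝ, E) N)) x →
    mvfderiv 𝓘(ℝ, E) (fun y ↦ g.val y (Y y) (Z y)) x v
      = g.val x (nabla Y x v) (Z x) + g.val x (Y x) (nabla Z x v)

/-- The value at `x` of `(∇_X φ) Y = ∇_X (φ Y) - φ (∇_X Y)`. -/
def covDerivEndo (nabla : CovariantDerivative 𝓘(ℝ, E) E (TangentSpace 𝓘(ℝ, E) : N → Type _))
    (φ : ∀ x : N, TangentSpace 𝓘(ℝ, E) x →L[ℝ] TangentSpace 𝓘(ℝ, E) x)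
    (X Y : ∀ x : N, TangentSpace 𝓘(ℝ, E) x) (x : N) : TangentSpace 𝓘(ℝ, E) x :=
  nabla (fun y ↦ φ y (Y y)) x (X x) - φ x (nabla Y x (X x))

/-- The nearly `μ`-Sasakian condition on an indefinite almost contact metric manifold with
Levi-Civita connection `nabla`. -/
def IsNearlySasakian {g : SemiRiemannianMetric E N} (c : AlmostContactMetric g)
    (nabla : CovariantDerivative 𝓘(ℝ, E) E (TangentSpace 𝓘(ℝ, E) : N → Type _)) (μ : ℝ) : Prop :=
  ∀ (X Y : ∀ x : N, TangentSpace 𝓘(ℝ, E) x) (x : N),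
    MDifferentiableAt 𝓘(ℝ, E) 𝓘(ℝ, E).tangent
      (fun y ↦ (⟨y, X y⟩ : TangentBundle 𝓘(ℝ, E) N)) x →
    MDifferentiableAt 𝓘(ℝ, E) 𝓘(ℝ, E).tangent
      (fun y ↦ (⟨y, Y y⟩ : TangentBundle 𝓘(ℝ, E) N)) x →
    covDerivEndo nabla c.φ X Y x + covDerivEndo nabla c.φ Y X x
      = μ • ((2 * g.val x (X x) (Y x)) • c.ξ x - c.η x (Y x) • X x - c.η x (X x) • Y x)

/-- The `g`-orthogonal complement of a subspace of a tangent space. -/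
def SemiRiemannianMetric.orth (g : SemiRiemannianMetric E N) {x : N}
    (W : Submodule ℝ (TangentSpace 𝓘(ℝ, E) x)) : Submodule ℝ (TangentSpace 𝓘(ℝ, E) x) where
  carrier := {v | ∀ w ∈ W, g.val x v w = 0}
  add_mem' ha hb w hw := by simp [ha w hw, hb w hw]
  zero_mem' w _ := by simp
  smul_mem' c v hv w hw := by simp [hv w hw]

/-- `g` is nondegenerate on the subspace `W`. -/
def SemiRiemannianMetric.NondegenerateOn (g : SemiRiemannianMetric E N) {x : N}
    (W : Submodule ℝ (TangentSpace 𝓘(ℝ, E) x)) : Prop :=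
  Disjoint W (g.orth W)

variable {g : SemiRiemannianMetric E N} (c : AlmostContactMetric g)

/-- The image under `φ` of a subspace of a tangent space. -/
def AlmostContactMetric.phiImage {x : N} (W : Submodule ℝ (TangentSpace 𝓘(ℝ, E) x)) :
    Submodule ℝ (TangentSpace 𝓘(ℝ, E) x) :=
  W.map (c.φ x).toLinearMap

/-- The line `ℝξ` spanned by `ξ`. -/
def AlmostContactMetric.lineξ (x : N) : Submodule ℝ (TangentSpace 𝓘(ℝ, E) x) :=
  Submodule.span ℝ {c.ξ x}

end Ambient

section Submanifold

variable {E : Type*} [NormedAddCommGroup E] [NormedSpace ℝ E]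
  {N : Type*} [TopologicalSpace N] [ChartedSpace E N] [IsManifold 𝓘(ℝ, E) ∞ N]
  {E' : Type*} [NormedAddCommGroup E'] [NormedSpace ℝ E']
  {M : Type*} [TopologicalSpace M] [ChartedSpace E' M] [IsManifold 𝓘(ℝ, E') ∞ M]

/-! ### Sections and subbundles along an immersion

All bundles over `M` are regarded as subbundles of the pull-back of the tangent bundle of `N`, that
is, as families of subspaces of the tangent spaces `T_{i p} N`. -/

/-- A smooth vector field on `M`. -/
def SmoothField (X : ∀ p : M, TangentSpace 𝓘(ℝ, E') p) : Prop :=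
  ContMDiff 𝓘(ℝ, E') 𝓘(ℝ, E').tangent ∞ (fun p ↦ (⟨p, X p⟩ : TangentBundle 𝓘(ℝ, E') M))

/-- The differential of `i`, applied to a vector field on `M`. -/
def push (i : M → N) (X : ∀ p : M, TangentSpace 𝓘(ℝ, E') p) (p : M) :
    TangentSpace 𝓘(ℝ, E) (i p) :=
  mfderiv 𝓘(ℝ, E') 𝓘(ℝ, E) i p (X p)

variable (E') in
/-- The tangent space `T_p M`, as a subspace of `T_{i p} N`. -/
def tangentSub (i : M → N) (p : M) : Submodule ℝ (TangentSpace 𝓘(ℝ, E) (i p)) :=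
  LinearMap.range (mfderiv 𝓘(ℝ, E') 𝓘(ℝ, E) i p).toLinearMap

variable (E') in
/-- The family of subspaces `W p ⊆ T_{i p} N` is a smooth vector bundle: near each point it has a
smooth frame. -/
def IsSmoothSubbundle (i : M → N) (W : ∀ p : M, Submodule ℝ (TangentSpace 𝓘(ℝ, E) (i p))) : Prop :=
  ∀ p : M, ∃ u : Set M, IsOpen u ∧ p ∈ u ∧
    ∃ (k : ℕ) (s : Fin k → ∀ q : M, TangentSpace 𝓘(ℝ, E) (i q)),
      (∀ a, ContMDiffOn 𝓘(ℝ, E') 𝓘(ℝ, E).tangent ∞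
        (fun q ↦ (⟨i q, s a q⟩ : TangentBundle 𝓘(ℝ, E) N)) u) ∧
      ∀ q ∈ u, LinearIndependent ℝ (fun a ↦ s a q) ∧
        Submodule.span ℝ (Set.range fun a ↦ s a q) = W q

/-- The covariant derivative `∇_v V` at `p` of a section `V` along `i` in the direction `v ∈ T_p M`
(the pull-back connection). In the trivialization `e` of the tangent bundle of `N` at `i p`, with
components `c` of `V`, this is `∂_v c` plus the derivative in the direction `di(v)` of the vector
field on `N` with the constant components `c p`. -/
def covAlong (nabla : CovariantDerivative 𝓘(ℝ, E) E (TangentSpace 𝓘(ℝ, E) : N → Type _))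
    (i : M → N) (V : ∀ p : M, TangentSpace 𝓘(ℝ, E) (i p)) (p : M)
    (v : TangentSpace 𝓘(ℝ, E') p) : TangentSpace 𝓘(ℝ, E) (i p) :=
  let e := trivializationAt E (TangentSpace 𝓘(ℝ, E) : N → Type _) (i p)
  let c : M → E := fun q ↦ (e ⟨i q, V q⟩).2
  e.symm (i p) (mvfderiv 𝓘(ℝ, E') c p v)
    + nabla (fun x ↦ e.symm x (c p)) (i p) (mfderiv 𝓘(ℝ, E') 𝓘(ℝ, E) i p v)

/-- `φ X` for a vector field `X` on `M`, as a section along `i`. -/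
def phiPush {g : SemiRiemannianMetric E N} (c : AlmostContactMetric g) (i : M → N)
    (X : ∀ p : M, TangentSpace 𝓘(ℝ, E') p) (p : M) : TangentSpace 𝓘(ℝ, E) (i p) :=
  c.φ (i p) (push i X p)

/-! ### Lightlike submanifolds -/

variable (E') in
/-- The radical `Rad T_p M = T_p M ∩ T_p M^⊥`. -/
def rad (g : SemiRiemannianMetric E N) (i : M → N) (p : M) :
    Submodule ℝ (TangentSpace 𝓘(ℝ, E) (i p)) :=
  tangentSub E' i p ⊓ g.orth (tangentSub E' i p)

variable (E') in
/-- An `r`-lightlike immersed submanifold `(M, g, S(TM), S(TM^⊥))`, together with a lightlike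
transversal bundle `ltr(TM)`. -/
structure LightlikeSubmanifold (g : SemiRiemannianMetric E N) (i : M → N) (r : ℕ) where
  /-- the screen distribution `S(TM)` -/
  screen : ∀ p : M, Submodule ℝ (TangentSpace 𝓘(ℝ, E) (i p))
  /-- the screen transversal bundle `S(TM^⊥)` -/
  screenTr : ∀ p : M, Submodule ℝ (TangentSpace 𝓘(ℝ, E) (i p))
  /-- the lightlike transversal bundle `ltr(TM)` -/
  ltr : ∀ p : M, Submodule ℝ (TangentSpace 𝓘(ℝ, E) (i p))
  smooth_i : ContMDiff 𝓘(ℝ, E') 𝓘(ℝ, E) ∞ i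
  immersion : ∀ p, Function.Injective (mfderiv 𝓘(ℝ, E') 𝓘(ℝ, E) i p)
  r_pos : 0 < r
  smooth_rad : IsSmoothSubbundle E' i (rad E' g i)
  finrank_rad : ∀ p, Module.finrank ℝ (rad E' g i p) = r
  smooth_screen : IsSmoothSubbundle E' i screen
  rad_sup_screen : ∀ p, rad E' g i p ⊔ screen p = tangentSub E' i p
  rad_disjoint_screen : ∀ p, Disjoint (rad E' g i p) (screen p)
  screen_nondegenerate : ∀ p, g.NondegenerateOn (screen p)
  smooth_screenTr : IsSmoothSubbundle E' i screenTr
  rad_sup_screenTr : ∀ p, rad E' g i p ⊔ screenTr p = g.orth (tangentSub E' i p)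
  rad_disjoint_screenTr : ∀ p, Disjoint (rad E' g i p) (screenTr p)
  screenTr_nondegenerate : ∀ p, g.NondegenerateOn (screenTr p)
  smooth_ltr : IsSmoothSubbundle E' i ltr
  ltr_orth_screen : ∀ p, ltr p ≤ g.orth (screen p)
  ltr_orth_screenTr : ∀ p, ltr p ≤ g.orth (screenTr p)
  ltr_null : ∀ p, ltr p ≤ g.orth (ltr p)
  /-- every basis `E_1, …, E_r` of the radical has a dual basis `N_1, …, N_r` of `ltr(TM)` -/
  ltr_dual : ∀ (p : M) (e : Module.Basis (Fin r) ℝ (rad E' g i p)),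
    ∃ n : Module.Basis (Fin r) ℝ (ltr p), ∀ a b : Fin r,
      g.val (i p) (e a : TangentSpace 𝓘(ℝ, E) (i p)) (n b : TangentSpace 𝓘(ℝ, E) (i p))
        = if a = b then 1 else 0

namespace LightlikeSubmanifold

variable {g : SemiRiemannianMetric E N} {i : M → N} {r : ℕ}

/-- The transversal bundle `tr(TM) = ltr(TM) ⊥ S(TM^⊥)`, a complement of `TM`. -/
def tr (A : LightlikeSubmanifold E' g i r) (p : M) :
    Submodule ℝ (TangentSpace 𝓘(ℝ, E) (i p)) :=
  A.ltr p ⊔ A.screenTr p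

open Classical in
/-- The tangential component of `v ∈ T_{i p} N = T_p M ⊕ tr(TM)_p`, as a vector of `T_p M`. -/
def tanPart (A : LightlikeSubmanifold E' g i r) (p : M)
    (v : TangentSpace 𝓘(ℝ, E) (i p)) : TangentSpace 𝓘(ℝ, E') p :=
  if h : ∃ u : TangentSpace 𝓘(ℝ, E') p, v - mfderiv 𝓘(ℝ, E') 𝓘(ℝ, E) i p u ∈ A.tr p
  then h.choose else 0

/-- The transversal component of `v ∈ T_{i p} N = T_p M ⊕ tr(TM)_p`. -/
def trPart (A : LightlikeSubmanifold E' g i r) (p : M)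
    (v : TangentSpace 𝓘(ℝ, E) (i p)) : TangentSpace 𝓘(ℝ, E) (i p) :=
  v - mfderiv 𝓘(ℝ, E') 𝓘(ℝ, E) i p (A.tanPart p v)

variable (A : LightlikeSubmanifold E' g i r)
  (nabla : CovariantDerivative 𝓘(ℝ, E) E (TangentSpace 𝓘(ℝ, E) : N → Type _))

/-- The induced connection on `TM`: `∇_X Y` is the tangential component of the ambient one. -/
def inducedConn (X Y : ∀ p : M, TangentSpace 𝓘(ℝ, E') p) (p : M) : TangentSpace 𝓘(ℝ, E') p :=
  A.tanPart p (covAlong nabla i (push i Y) p (X p))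

/-- The second fundamental form `h(X, V)`, for a vector field `V` tangent to `M` but written as a
section along `i`: the transversal component of the ambient derivative of `V`. -/
def secondFF (X : ∀ p : M, TangentSpace 𝓘(ℝ, E') p)
    (V : ∀ p : M, TangentSpace 𝓘(ℝ, E) (i p)) (p : M) : TangentSpace 𝓘(ℝ, E) (i p) :=
  A.trPart p (covAlong nabla i V p (X p))

/-- The transversal connection `∇^t_X V`, for a section `V` of `tr(TM)`: the transversal component
of the ambient derivative of `V`. -/
def trConn (X : ∀ p : M, TangentSpace 𝓘(ℝ, E') p)
    (V : ∀ p : M, TangentSpace 𝓘(ℝ, E) (i p)) (p : M) : TangentSpace 𝓘(ℝ, E) (i p) :=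
  A.trPart p (covAlong nabla i V p (X p))

variable (c : AlmostContactMetric g)

/-- The tangential component `φ₁ X` of `φ X`. -/
def phiTan (X : ∀ p : M, TangentSpace 𝓘(ℝ, E') p) (p : M) : TangentSpace 𝓘(ℝ, E') p :=
  A.tanPart p (phiPush c i X p)

/-- The transversal component `ϕ₁ X` of `φ X`. -/
def phiTr (X : ∀ p : M, TangentSpace 𝓘(ℝ, E') p) (p : M) : TangentSpace 𝓘(ℝ, E) (i p) :=
  A.trPart p (phiPush c i X p)

/-! ### Co-screen QGCR-lightlike submanifolds -/

/-- A quasi generalized CR structure on a lightlike submanifold. -/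
structure QGCR where
  D₀ : ∀ p : M, Submodule ℝ (TangentSpace 𝓘(ℝ, E) (i p))
  D₁ : ∀ p : M, Submodule ℝ (TangentSpace 𝓘(ℝ, E) (i p))
  D₂ : ∀ p : M, Submodule ℝ (TangentSpace 𝓘(ℝ, E) (i p))
  L : ∀ p : M, Submodule ℝ (TangentSpace 𝓘(ℝ, E) (i p))
  S : ∀ p : M, Submodule ℝ (TangentSpace 𝓘(ℝ, E) (i p))
  smooth_D₀ : IsSmoothSubbundle E' i D₀
  smooth_D₁ : IsSmoothSubbundle E' i D₁
  smooth_D₂ : IsSmoothSubbundle E' i D₂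
  smooth_L : IsSmoothSubbundle E' i L
  smooth_S : IsSmoothSubbundle E' i S
  /-- `Rad TM = D₁ ⊕ D₂` -/
  D₁_sup_D₂ : ∀ p, D₁ p ⊔ D₂ p = rad E' g i p
  D₁_disjoint_D₂ : ∀ p, Disjoint (D₁ p) (D₂ p)
  phi_D₁ : ∀ p, c.phiImage (D₁ p) = D₁ p
  phi_D₂ : ∀ p, c.phiImage (D₂ p) ≤ A.screen p
  L_le : ∀ p, L p ≤ A.ltr p
  S_le : ∀ p, S p ≤ A.screenTr p
  /-- the sum `φ S + φ L` is direct -/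
  phi_S_disjoint_phi_L : ∀ p, Disjoint (c.phiImage (S p)) (c.phiImage (L p))
  /-- `S(TM) = (φ D₂ ⊕ (φ S ⊕ φ L)) ⊥ D₀` -/
  screen_eq : ∀ p,
    (c.phiImage (D₂ p) ⊔ (c.phiImage (S p) ⊔ c.phiImage (L p))) ⊔ D₀ p = A.screen p
  phi_D₂_disjoint : ∀ p,
    Disjoint (c.phiImage (D₂ p)) (c.phiImage (S p) ⊔ c.phiImage (L p))
  D₀_disjoint : ∀ p,
    Disjoint (c.phiImage (D₂ p) ⊔ (c.phiImage (S p) ⊔ c.phiImage (L p))) (D₀ p)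
  D₀_orth : ∀ p,
    D₀ p ≤ g.orth (c.phiImage (D₂ p) ⊔ (c.phiImage (S p) ⊔ c.phiImage (L p)))
  D₀_nondegenerate : ∀ p, g.NondegenerateOn (D₀ p)
  phi_D₀ : ∀ p, c.phiImage (D₀ p) ≤ D₀ p

namespace QGCR

variable {A c} (Q : A.QGCR c)

/-- The distribution `D̄ = φ S ⊕ φ L`. -/
def Dbar (p : M) : Submodule ℝ (TangentSpace 𝓘(ℝ, E) (i p)) :=
  c.phiImage (Q.S p) ⊔ c.phiImage (Q.L p)

/-- The distribution `D = Rad TM ⊥ D₀ ⊥ φ D₂`, for which `TM = D ⊕ D̄`. -/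
def D (p : M) : Submodule ℝ (TangentSpace 𝓘(ℝ, E) (i p)) :=
  rad E' g i p ⊔ Q.D₀ p ⊔ c.phiImage (Q.D₂ p)

/-- A QGCR-lightlike submanifold is co-screen if `ξ` is a section of `S(TM^⊥)`; the subbundles `L`
and `S` satisfy `φ D̄ = S ⊥ L`. -/
structure IsCoScreen : Prop where
  ξ_mem : ∀ p, c.ξ (i p) ∈ A.screenTr p
  phi_Dbar : ∀ p, c.phiImage (Q.Dbar p) = Q.S p ⊔ Q.L p

/-- `G` is a subspace with `tr(TM) = (L ⊥ S) ⊥ G ⊥ ℝξ` at `p`. -/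
structure IsTransversalDecomposition (p : M)
    (G : Submodule ℝ (TangentSpace 𝓘(ℝ, E) (i p))) : Prop where
  sup_eq : (Q.L p ⊔ Q.S p) ⊔ (G ⊔ c.lineξ (i p)) = A.tr p
  L_disjoint_S : Disjoint (Q.L p) (Q.S p)
  G_disjoint_ξ : Disjoint G (c.lineξ (i p))
  disjoint : Disjoint (Q.L p ⊔ Q.S p) (G ⊔ c.lineξ (i p))
  L_orth_S : Q.L p ≤ g.orth (Q.S p)
  LS_orth_G : Q.L p ⊔ Q.S p ≤ g.orth G
  LS_orth_ξ : Q.L p ⊔ Q.S p ≤ g.orth (c.lineξ (i p))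
  G_orth_ξ : G ≤ g.orth (c.lineξ (i p))

/-- The bundle `G` of those vectors of `tr(TM)` that are orthogonal to `D₂`, to `S` and to `ξ`. -/
def G (p : M) : Submodule ℝ (TangentSpace 𝓘(ℝ, E) (i p)) :=
  A.tr p ⊓ g.orth (Q.D₂ p) ⊓ g.orth (Q.S p) ⊓ g.orth (c.lineξ (i p))

/-- The transversal vector `V` has no component in `L ⊥ S`, with respect to
`tr(TM) = (L ⊥ S) ⊥ G ⊥ ℝξ`. -/
def NoComponentLS (p : M) (V : TangentSpace 𝓘(ℝ, E) (i p)) : Prop :=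
  V ∈ Q.G p ⊔ c.lineξ (i p)

end QGCR

/-- A distribution `D` on `M` is nearly parallel (for the induced connection) if
`∇_X Y + ∇_Y X ∈ Γ(D)` for all `X ∈ Γ(TM)` and `Y ∈ Γ(D)`. -/
def NearlyParallel (D : ∀ p : M, Submodule ℝ (TangentSpace 𝓘(ℝ, E) (i p))) : Prop :=
  ∀ X Y : ∀ p : M, TangentSpace 𝓘(ℝ, E') p, SmoothField X → SmoothField Y →
    (∀ p, push i Y p ∈ D p) →
    ∀ p, push i (A.inducedConn nabla X Y + A.inducedConn nabla Y X) p ∈ D p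

/-- The transversal field `h(X, φ Y) + h(Y, φ₁ X) + ∇^t_Y ϕ₁ X`. -/
def transversalField (X Y : ∀ p : M, TangentSpace 𝓘(ℝ, E') p) (p : M) :
    TangentSpace 𝓘(ℝ, E) (i p) :=
  A.secondFF nabla X (phiPush c i Y) p + A.secondFF nabla Y (push i (A.phiTan c X)) p
    + A.trConn nabla Y (A.phiTr c X) p

end LightlikeSubmanifold

end Submanifold

end Lightlike

end

/-! The nearly `μ`-Sasakian identity symmetrizes the derivatives of `φ`. Since `ξ` is normal to `M`,
`η` vanishes on `TM`, and for tangent fields the identity along the immersion reads `∇̄_X φY + ∇̄_Y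
φX = φ(∇̄_X Y + ∇̄_Y X) + 2μ g(X,Y) ξ`. Splitting `φX` into its two components before
differentiating shows that the transversal part of the left side is the field in question.

On the right, `∇̄_X Y + ∇̄_Y X` is a vector of `D` plus a vector of `tr(TM)`. Now `φ` sends `D`, `L`
and `S` into `TM` and kills `ξ`, while the transversal part of `φ` of a vector of `G` is again in
`G`. Hence only `G` and `ξ` survive (`trPart_φ_mem_G`, `noComponentLS`).

The splitting itself comes from nondegeneracy of the screen: through `φ` it makes `L` and `D₂` dual
and `S` nondegenerate (`eq_zero_of_mem_orth`), so components along `L` and `S` can be subtracted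
(`tr_le_sup`). An invariant third summand is orthogonal to `D₂` because `φ` preserves products there
and `tr(TM)` is orthogonal to the screen; complementarity then forces equality with `G`.

The analytic input is a product rule for `φ` along the immersion (`covAlong_endo`) and
differentiability of the two components of `φX` (`DiffAlong.left_of_isCompl`). -/

noncomputable section

namespace Lightlike

/-! ### Covariant differentiation along a map, in a trivialization. -/

section Along

variable {E : Type*} [NormedAddCommGroup E] [NormedSpace ℝ E]
  {N : Type*} [TopologicalSpace N] [ChartedSpace E N] [IsManifold 𝓘(ℝ, E) ∞ N]
  {E' : Type*} [NormedAddCommGroup E'] [NormedSpace ℝ E']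
  {M : Type*} [TopologicalSpace M] [ChartedSpace E' M]

/-- The local vector field with constant components `y` in the trivialization of `TN` at `x₀`. -/
def constField (x₀ : N) (y : E) (x : N) : TangentSpace 𝓘(ℝ, E) x :=
  (trivializationAt E (TangentSpace 𝓘(ℝ, E) : N → Type _) x₀).symmL ℝ x y

/-- The components of `v ∈ T_x N` in the trivialization of `TN` at `x₀`. -/
def comps (x₀ x : N) (v : TangentSpace 𝓘(ℝ, E) x) : E :=
  (trivializationAt E (TangentSpace 𝓘(ℝ, E) : N → Type _) x₀ ⟨x, v⟩).2

variable (E') in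
/-- A section along `i` is differentiable at `p`. -/
def DiffAlong (i : M → N) (V : ∀ p : M, TangentSpace 𝓘(ℝ, E) (i p)) (p : M) : Prop :=
  MDifferentiableAt 𝓘(ℝ, E') 𝓘(ℝ, E).tangent
    (fun q ↦ (⟨i q, V q⟩ : TangentBundle 𝓘(ℝ, E) N)) p

theorem eventually_mem_baseSet (x₀ : N) :
    ∀ᶠ x in 𝓝 x₀, x ∈ (trivializationAt E (TangentSpace 𝓘(ℝ, E) : N → Type _) x₀).baseSet :=
  (trivializationAt E (TangentSpace 𝓘(ℝ, E) : N → Type _) x₀).open_baseSet.mem_nhds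
    (mem_baseSet_trivializationAt E _ x₀)

theorem constField_comps {x₀ x : N}
    (hx : x ∈ (trivializationAt E (TangentSpace 𝓘(ℝ, E) : N → Type _) x₀).baseSet)
    (v : TangentSpace 𝓘(ℝ, E) x) : constField x₀ (comps x₀ x v) x = v := by
  rw [constField, Trivialization.symmL_apply _ hx]
  exact Trivialization.symm_apply_apply_mk _ hx v

theorem comps_constField {x₀ x : N}
    (hx : x ∈ (trivializationAt E (TangentSpace 𝓘(ℝ, E) : N → Type _) x₀).baseSet)
    (y : E) : comps x₀ x (constField x₀ y x) = y := by
  rw [constField, Trivialization.symmL_apply _ hx, comps, Trivialization.apply_mk_symm _ hx]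

theorem comps_eq_equiv {x₀ x : N}
    (hx : x ∈ (trivializationAt E (TangentSpace 𝓘(ℝ, E) : N → Type _) x₀).baseSet)
    (v : TangentSpace 𝓘(ℝ, E) x) :
    comps x₀ x v = (trivializationAt E (TangentSpace 𝓘(ℝ, E) : N → Type _) x₀).continuousLinearEquivAt
      ℝ x hx v := by
  rw [Trivialization.continuousLinearEquivAt_apply]; rfl

theorem comps_add {x₀ x : N}
    (hx : x ∈ (trivializationAt E (TangentSpace 𝓘(ℝ, E) : N → Type _) x₀).baseSet)
    (v w : TangentSpace 𝓘(ℝ, E) x) : comps x₀ x (v + w) = comps x₀ x v + comps x₀ x w := by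
  simp only [comps_eq_equiv hx, map_add]

theorem diffAlong_iff {i : M → N} {V : ∀ p : M, TangentSpace 𝓘(ℝ, E) (i p)} {p : M} :
    DiffAlong E' i V p ↔ MDifferentiableAt 𝓘(ℝ, E') 𝓘(ℝ, E) i p ∧
      MDifferentiableAt 𝓘(ℝ, E') 𝓘(ℝ, E) (fun q ↦ comps (i p) (i q) (V q)) p :=
  mdifferentiableAt_totalSpace _ _

theorem mdifferentiableAt_constField (x₀ : N) (y : E) :
    MDifferentiableAt 𝓘(ℝ, E) 𝓘(ℝ, E).tangent
      (fun x ↦ (⟨x, constField x₀ y x⟩ : TangentBundle 𝓘(ℝ, E) N)) x₀ := by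
  refine (mdifferentiableAt_totalSpace _ _).2 ⟨mdifferentiableAt_id, ?_⟩
  refine (mdifferentiableAt_const (c := y)).congr_of_eventuallyEq ?_
  filter_upwards [eventually_mem_baseSet (E := E) x₀] with x hx
  exact comps_constField hx y

theorem mdifferentiableAt_constField_fun {x₀ : N} {f : N → E}
    (hf : MDifferentiableAt 𝓘(ℝ, E) 𝓘(ℝ, E) f x₀) :
    MDifferentiableAt 𝓘(ℝ, E) 𝓘(ℝ, E).tangent
      (fun x ↦ (⟨x, constField x₀ (f x) x⟩ : TangentBundle 𝓘(ℝ, E) N)) x₀ := by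
  refine (mdifferentiableAt_totalSpace _ _).2 ⟨mdifferentiableAt_id, ?_⟩
  refine hf.congr_of_eventuallyEq ?_
  filter_upwards [eventually_mem_baseSet (E := E) x₀] with x hx
  exact comps_constField hx (f x)

theorem constField_add (x₀ : N) (y z : E) :
    (constField x₀ (y + z) : ∀ x : N, TangentSpace 𝓘(ℝ, E) x)
      = constField x₀ y + constField x₀ z := by
  funext x; simp [constField]

theorem constField_smul (x₀ : N) (a : ℝ) (y : E) :
    (constField x₀ (a • y) : ∀ x : N, TangentSpace 𝓘(ℝ, E) x) = a • constField x₀ y := by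
  funext x; simp [constField]

variable (nabla : CovariantDerivative 𝓘(ℝ, E) E (TangentSpace 𝓘(ℝ, E) : N → Type _))

/-- A covariant derivative depends only on the germ of the field, so the `symm` of the definition
may be traded for `symmL`, which is linear in the components, as soon as the two agree on the base
set. -/
theorem covAlong_eq (i : M → N) (V : ∀ p : M, TangentSpace 𝓘(ℝ, E) (i p)) (p : M)
    (v : TangentSpace 𝓘(ℝ, E') p) :
    covAlong nabla i V p v
      = constField (i p) (mvfderiv 𝓘(ℝ, E') (fun q ↦ comps (i p) (i q) (V q)) p v) (i p)
        + nabla (constField (i p) (comps (i p) (i p) (V p))) (i p)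
            (mfderiv 𝓘(ℝ, E') 𝓘(ℝ, E) i p v) := by
  have hb := mem_baseSet_trivializationAt E (TangentSpace 𝓘(ℝ, E) : N → Type _) (i p)
  have hev : ∀ᶠ x in 𝓝 (i p), constField (i p) (comps (i p) (i p) (V p)) x
      = (trivializationAt E (TangentSpace 𝓘(ℝ, E) : N → Type _) (i p)).symm x
        (comps (i p) (i p) (V p)) := by
    filter_upwards [eventually_mem_baseSet (E := E) (i p)] with x hx
    exact Trivialization.symmL_apply _ hx _
  have hd := mdifferentiableAt_constField (i p) (comps (i p) (i p) (V p))
  rw [nabla.isCovariantDerivativeOnUniv.congr_of_eventuallyEq hd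
    (hd.congr_of_eventuallyEq (hev.mono fun x hx ↦ by dsimp only; rw [hx])) Filter.univ_mem hev]
  rw [covAlong, constField, Trivialization.symmL_apply _ hb]
  rfl

theorem covAlong_add [FiniteDimensional ℝ E] {i : M → N}
    {V W : ∀ p : M, TangentSpace 𝓘(ℝ, E) (i p)} {p : M}
    (hV : DiffAlong E' i V p) (hW : DiffAlong E' i W p)
    (v : TangentSpace 𝓘(ℝ, E') p) :
    covAlong nabla i (fun q ↦ V q + W q) p v
      = covAlong nabla i V p v + covAlong nabla i W p v := by
  obtain ⟨hi, hV⟩ := diffAlong_iff.1 hV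
  obtain ⟨-, hW⟩ := diffAlong_iff.1 hW
  have hev : (fun q ↦ comps (i p) (i q) (V q + W q))
      =ᶠ[𝓝 p] (fun q ↦ comps (i p) (i q) (V q) + comps (i p) (i q) (W q)) := by
    filter_upwards [hi.continuousAt.eventually (eventually_mem_baseSet (E := E) (i p))] with q hq
    exact comps_add hq _ _
  have hd : mvfderiv 𝓘(ℝ, E') (fun q ↦ comps (i p) (i q) (V q + W q)) p v
      = mvfderiv 𝓘(ℝ, E') (fun q ↦ comps (i p) (i q) (V q)) p v
        + mvfderiv 𝓘(ℝ, E') (fun q ↦ comps (i p) (i q) (W q)) p v := by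
    rw [mvfderiv, hev.mfderiv_eq]
    exact congr($(mvfderiv_fun_add hV hW) v)
  simp only [covAlong_eq]
  rw [hd, show comps (i p) (i p) (V p + W p) = _ from hev.self_of_nhds, constField_add,
    constField_add,
    nabla.isCovariantDerivativeOnUniv.add (mdifferentiableAt_constField _ _)
      (mdifferentiableAt_constField _ _)]
  simp only [Pi.add_apply, add_apply]
  abel

/-- Expanding `f` in a basis of `E` turns the field into a finite sum of functions times
constant-component fields, where the Leibniz rule applies. Differentiability is carried through the
induction because additivity of `nabla` needs it. -/
theorem nabla_constField_fun [FiniteDimensional ℝ E] {x₀ : N} {f : N → E}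
    (hf : MDifferentiableAt 𝓘(ℝ, E) 𝓘(ℝ, E) f x₀) (w : TangentSpace 𝓘(ℝ, E) x₀) :
    nabla (fun x ↦ constField x₀ (f x) x) x₀ w
      = nabla (constField x₀ (f x₀)) x₀ w + constField x₀ (mvfderiv 𝓘(ℝ, E) f x₀ w) x₀ := by
  set b := Module.finBasis ℝ E
  have hcov := nabla.isCovariantDerivativeOnUniv
  have hc : ∀ k, MDifferentiableAt 𝓘(ℝ, E) 𝓘(ℝ, ℝ) (fun x ↦ b.coord k (f x)) x₀ := fun k ↦
    (LinearMap.toContinuousLinearMap (b.coord k)).differentiableAt.comp_mdifferentiableAt hf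
  have hsum : ∀ (s : Finset (Fin (Module.finrank ℝ E))),
      MDifferentiableAt 𝓘(ℝ, E) 𝓘(ℝ, E) (fun x ↦ ∑ k ∈ s, b.coord k (f x) • b k) x₀ ∧
      nabla (fun x ↦ constField x₀ (∑ k ∈ s, b.coord k (f x) • b k) x) x₀ w
        = nabla (constField x₀ (∑ k ∈ s, b.coord k (f x₀) • b k)) x₀ w
          + constField x₀ (mvfderiv 𝓘(ℝ, E) (fun x ↦ ∑ k ∈ s, b.coord k (f x) • b k) x₀ w) x₀ := by
    intro s
    induction s using Finset.induction_on with
    | empty =>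
      refine ⟨by simpa using mdifferentiableAt_const, ?_⟩
      have h0 : (fun x ↦ constField x₀ 0 x : ∀ x : N, TangentSpace 𝓘(ℝ, E) x) = constField x₀ 0 := rfl
      simp only [Finset.sum_empty, mvfderiv_const, zero_apply, h0]
      simp [constField]
    | insert k s hk ih =>
      obtain ⟨hd, ih⟩ := ih
      have hk1 : MDifferentiableAt 𝓘(ℝ, E) 𝓘(ℝ, E) (fun x ↦ b.coord k (f x) • b k) x₀ :=
        (hc k).smul mdifferentiableAt_const
      simp only [Finset.sum_insert hk]
      refine ⟨hk1.add hd, ?_⟩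
      have e1 : (fun x ↦ constField x₀ (b.coord k (f x) • b k + ∑ k ∈ s, b.coord k (f x) • b k) x)
          = (fun x ↦ b.coord k (f x)) • constField x₀ (b k)
            + fun x ↦ constField x₀ (∑ k ∈ s, b.coord k (f x) • b k) x := by
        funext x
        rw [constField_add, constField_smul]
        rfl
      have hs1 : MDifferentiableAt 𝓘(ℝ, E) 𝓘(ℝ, E).tangent
          (fun x ↦ (⟨x, ((fun x ↦ b.coord k (f x)) • constField x₀ (b k)) x⟩ :
            TangentBundle 𝓘(ℝ, E) N)) x₀ :=
        (hc k).smul_section (mdifferentiableAt_constField x₀ (b k))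
      rw [e1, hcov.add hs1 (mdifferentiableAt_constField_fun hd),
        hcov.leibniz (mdifferentiableAt_constField x₀ (b k)) (hc k),
        add_apply, ih, constField_add, constField_smul,
        hcov.add (by rw [← constField_smul]; exact mdifferentiableAt_constField _ _)
          (mdifferentiableAt_constField _ _),
        hcov.smul_const _ (mdifferentiableAt_constField _ _),
        mvfderiv_fun_add hk1 hd, mvfderiv_fun_smul (hc k) mdifferentiableAt_const, mvfderiv_const]
      simp only [add_apply, smul_apply, smul_zero, zero_add,
        ContinuousLinearMap.smulRight_apply, constField_add, constField_smul, Pi.add_apply,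
        Pi.smul_apply]
      abel
  have key : ∀ x, ∑ k, b.coord k (f x) • b k = f x := fun x ↦ b.sum_repr (f x)
  simpa only [key] using (hsum Finset.univ).2

theorem mvfderiv_clm_apply {F₁ F₂ : Type*} [NormedAddCommGroup F₁] [NormedSpace ℝ F₁]
    [NormedAddCommGroup F₂] [NormedSpace ℝ F₂] {A : M → F₁ →L[ℝ] F₂} {f : M → F₁} {p : M}
    (hA : MDifferentiableAt 𝓘(ℝ, E') 𝓘(ℝ, F₁ →L[ℝ] F₂) A p)
    (hf : MDifferentiableAt 𝓘(ℝ, E') 𝓘(ℝ, F₁) f p) (v : TangentSpace 𝓘(ℝ, E') p) :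
    mvfderiv 𝓘(ℝ, E') (fun q ↦ A q (f q)) p v
      = A p (mvfderiv 𝓘(ℝ, E') f p v) + mvfderiv 𝓘(ℝ, E') A p v (f p) := by
  have h := hA.hasMFDerivAt.2.clm_apply hf.hasMFDerivAt.2
  have h' : HasMFDerivAt 𝓘(ℝ, E') 𝓘(ℝ, F₂) (fun q ↦ A q (f q)) p _ :=
    ⟨(hA.clm_apply hf).continuousAt, h⟩
  rw [mvfderiv, h'.mfderiv]
  simp only [writtenInExtChartAt, extChartAt_model_space_eq_id, PartialEquiv.refl_coe,
    Function.comp_apply, id_eq, extChartAt_to_inv]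
  rfl

/-- The endomorphism `φ x` in the trivialization of `TN` at `x₀`. -/
def endoComps (φ : ∀ x : N, TangentSpace 𝓘(ℝ, E) x →L[ℝ] TangentSpace 𝓘(ℝ, E) x) (x₀ x : N) :
    E →L[ℝ] E :=
  ContinuousLinearMap.inCoordinates E (TangentSpace 𝓘(ℝ, E) : N → Type _) E
    (TangentSpace 𝓘(ℝ, E) : N → Type _) x₀ x x₀ x (φ x)

theorem constField_endoComps
    (φ : ∀ x : N, TangentSpace 𝓘(ℝ, E) x →L[ℝ] TangentSpace 𝓘(ℝ, E) x) {x₀ x : N}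
    (hx : x ∈ (trivializationAt E (TangentSpace 𝓘(ℝ, E) : N → Type _) x₀).baseSet) (y : E) :
    constField x₀ (endoComps φ x₀ x y) x = φ x (constField x₀ y x) := by
  have : endoComps φ x₀ x y = comps x₀ x (φ x (constField x₀ y x)) := by
    rw [endoComps, ContinuousLinearMap.inCoordinates_eq hx hx, comps_eq_equiv hx]
    simp only [ContinuousLinearMap.comp_apply, ContinuousLinearEquiv.coe_coe]
    congr 2
    rw [constField, Trivialization.symmL_apply _ hx]
    rfl
  rw [this, constField_comps hx]

/-- Covariant differentiation along `i` of `φ V`, up to `φ` of the derivative of `V`, is given by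
the covariant derivative of `φ` on `N`. -/
theorem covAlong_endo [FiniteDimensional ℝ E]
    {φ : ∀ x : N, TangentSpace 𝓘(ℝ, E) x →L[ℝ] TangentSpace 𝓘(ℝ, E) x}
    {i : M → N} {p : M}
    (hφ : MDifferentiableAt 𝓘(ℝ, E) (𝓘(ℝ, E).prod 𝓘(ℝ, E →L[ℝ] E))
      (fun x : N ↦ TotalSpace.mk' (E →L[ℝ] E)
        (E := fun x : N ↦ TangentSpace 𝓘(ℝ, E) x →L[ℝ] TangentSpace 𝓘(ℝ, E) x) x (φ x)) (i p))
    {V : ∀ p : M, TangentSpace 𝓘(ℝ, E) (i p)}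
    (hV : DiffAlong E' i V p) (v : TangentSpace 𝓘(ℝ, E') p)
    {X : ∀ x : N, TangentSpace 𝓘(ℝ, E) x} (hX : X (i p) = mfderiv 𝓘(ℝ, E') 𝓘(ℝ, E) i p v) :
    covAlong nabla i (fun q ↦ φ (i q) (V q)) p v - φ (i p) (covAlong nabla i V p v)
      = covDerivEndo nabla φ X (constField (i p) (comps (i p) (i p) (V p))) (i p) := by
  obtain ⟨hi, hV⟩ := diffAlong_iff.1 hV
  have hΦ : MDifferentiableAt 𝓘(ℝ, E) 𝓘(ℝ, E →L[ℝ] E) (endoComps φ (i p)) (i p) :=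
    ((mdifferentiableAt_hom_bundle _).1 hφ).2
  have hb := mem_baseSet_trivializationAt E (TangentSpace 𝓘(ℝ, E) : N → Type _) (i p)
  set c : M → E := fun q ↦ comps (i p) (i q) (V q) with hc
  set y : E := comps (i p) (i p) (V p) with hy
  have hev : (fun q ↦ comps (i p) (i q) (φ (i q) (V q)))
      =ᶠ[𝓝 p] (fun q ↦ endoComps φ (i p) (i q) (c q)) := by
    filter_upwards [hi.continuousAt.eventually (eventually_mem_baseSet (E := E) (i p))] with q hq
    rw [← comps_constField hq (endoComps φ (i p) (i q) (c q)), constField_endoComps φ hq,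
      constField_comps hq]
  -- Product rule for matrix times vector. The matrix depends on `q` only through `i q`, so by the
  -- chain rule its derivative is taken on `N` in the direction `di(v)`, with the vector frozen at
  -- `y`.
  have hd : mvfderiv 𝓘(ℝ, E') (fun q ↦ comps (i p) (i q) (φ (i q) (V q))) p v
      = endoComps φ (i p) (i p) (mvfderiv 𝓘(ℝ, E') c p v)
        + mvfderiv 𝓘(ℝ, E) (fun x ↦ endoComps φ (i p) x y) (i p)
            (mfderiv 𝓘(ℝ, E') 𝓘(ℝ, E) i p v) := by
    have h1 : mvfderiv 𝓘(ℝ, E') (fun q ↦ comps (i p) (i q) (φ (i q) (V q))) p v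
        = mvfderiv 𝓘(ℝ, E') (fun q ↦ endoComps φ (i p) (i q) (c q)) p v := by
      rw [mvfderiv, hev.mfderiv_eq]
      rfl
    have h2 : mvfderiv 𝓘(ℝ, E') (fun q ↦ endoComps φ (i p) (i q)) p v
        = mvfderiv 𝓘(ℝ, E) (endoComps φ (i p)) (i p) (mfderiv 𝓘(ℝ, E') 𝓘(ℝ, E) i p v) :=
      mfderiv_comp_apply p hΦ hi v
    rw [h1, mvfderiv_clm_apply (A := fun q ↦ endoComps φ (i p) (i q)) (hΦ.comp p hi) hV, h2,
      mvfderiv_clm_apply hΦ mdifferentiableAt_const, mvfderiv_const]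
    simp [hc, hy]
  -- Rewriting the field by its components lets `nabla_constField_fun` produce the same matrix
  -- derivative; it then cancels against the one in `hd`.
  have hZ : nabla (fun x ↦ φ x (constField (i p) y x)) (i p)
      = nabla (fun x ↦ constField (i p) (endoComps φ (i p) x y) x) (i p) := by
    have hd := mdifferentiableAt_constField_fun (hΦ.clm_apply (mdifferentiableAt_const (c := y)))
    have hev' : ∀ᶠ x in 𝓝 (i p), constField (i p) (endoComps φ (i p) x y) x
        = φ x (constField (i p) y x) := by
      filter_upwards [eventually_mem_baseSet (E := E) (i p)] with x hx
      exact constField_endoComps φ hx y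
    exact (nabla.isCovariantDerivativeOnUniv.congr_of_eventuallyEq hd
      (hd.congr_of_eventuallyEq (hev'.mono fun x hx ↦ by dsimp only; rw [hx]))
      Filter.univ_mem hev').symm
  rw [covDerivEndo, hZ, hX, nabla_constField_fun nabla (hΦ.clm_apply mdifferentiableAt_const),
    covAlong_eq, covAlong_eq, hd,
    show comps (i p) (i p) (φ (i p) (V p)) = _ from hev.self_of_nhds, constField_add]
  simp only [Pi.add_apply, map_add, constField_endoComps φ hb]
  rw [← hc, ← hy]
  abel

end Along

/-! ### Smooth frames and differentiability of components. -/

section Frames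

variable {E : Type*} [NormedAddCommGroup E] [NormedSpace ℝ E]
  {N : Type*} [TopologicalSpace N] [ChartedSpace E N] [IsManifold 𝓘(ℝ, E) ∞ N]
  {E' : Type*} [NormedAddCommGroup E'] [NormedSpace ℝ E']
  {M : Type*} [TopologicalSpace M] [ChartedSpace E' M]

theorem mdifferentiableAt_fun_sum {F ι : Type*} [NormedAddCommGroup F] [NormedSpace ℝ F]
    {s : Finset ι} {f : ι → M → F} {p : M}
    (hf : ∀ a ∈ s, MDifferentiableAt 𝓘(ℝ, E') 𝓘(ℝ, F) (f a) p) :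
    MDifferentiableAt 𝓘(ℝ, E') 𝓘(ℝ, F) (fun q ↦ ∑ a ∈ s, f a q) p := by
  induction s using Finset.cons_induction with
  | empty => simpa using mdifferentiableAt_const
  | cons a s ha ih =>
    simp only [Finset.sum_cons]
    exact (hf a (by simp)).add (ih fun b hb ↦ hf b (by simp [hb]))

/-- Local frames are concatenated over the intersection of their domains; disjointness keeps them
independent. -/
theorem IsSmoothSubbundle.sup {i : M → N}
    {W₁ W₂ : ∀ p : M, Submodule ℝ (TangentSpace 𝓘(ℝ, E) (i p))}
    (h₁ : IsSmoothSubbundle E' i W₁) (h₂ : IsSmoothSubbundle E' i W₂)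
    (hd : ∀ p, Disjoint (W₁ p) (W₂ p)) : IsSmoothSubbundle E' i (fun p ↦ W₁ p ⊔ W₂ p) := by
  intro p
  obtain ⟨u₁, ho₁, hp₁, k₁, s₁, hs₁, hf₁⟩ := h₁ p
  obtain ⟨u₂, ho₂, hp₂, k₂, s₂, hs₂, hf₂⟩ := h₂ p
  refine ⟨u₁ ∩ u₂, ho₁.inter ho₂, ⟨hp₁, hp₂⟩, k₁ + k₂,
    fun a ↦ Sum.elim s₁ s₂ (finSumFinEquiv.symm a), fun a ↦ ?_, fun q hq ↦ ?_⟩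
  · beta_reduce
    rcases finSumFinEquiv.symm a with a | a
    · exact (hs₁ a).mono Set.inter_subset_left
    · exact (hs₂ a).mono Set.inter_subset_right
  · obtain ⟨hl₁, hw₁⟩ := hf₁ q hq.1
    obtain ⟨hl₂, hw₂⟩ := hf₂ q hq.2
    have e : (fun a ↦ Sum.elim s₁ s₂ (finSumFinEquiv.symm a) q)
        = Sum.elim (fun a ↦ s₁ a q) (fun a ↦ s₂ a q) ∘ finSumFinEquiv.symm := by
      funext a
      rcases h : finSumFinEquiv.symm a with a | a <;> simp [h]
    rw [e]
    refine ⟨(hl₁.sum_type hl₂ (by rw [hw₁, hw₂]; exact hd q)).comp _ finSumFinEquiv.symm.injective,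
      ?_⟩
    rw [finSumFinEquiv.symm.surjective.range_comp, Set.Sum.elim_range, Submodule.span_union, hw₁,
      hw₂]

/-- If a differentiable section is the sum of sections of two complementary smooth subbundles, then
the summands are differentiable. -/
theorem DiffAlong.left_of_isCompl [FiniteDimensional ℝ E] {i : M → N}
    {W₁ W₂ : ∀ p : M, Submodule ℝ (TangentSpace 𝓘(ℝ, E) (i p))}
    (h₁ : IsSmoothSubbundle E' i W₁) (h₂ : IsSmoothSubbundle E' i W₂)
    (hc : ∀ p, IsCompl (W₁ p) (W₂ p)) {V₁ V₂ : ∀ p : M, TangentSpace 𝓘(ℝ, E) (i p)}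
    (hV₁ : ∀ p, V₁ p ∈ W₁ p) (hV₂ : ∀ p, V₂ p ∈ W₂ p) {p : M}
    (hV : DiffAlong E' i (fun q ↦ V₁ q + V₂ q) p) : DiffAlong E' i V₁ p := by
  obtain ⟨u₁, ho₁, hp₁, k₁, s₁, hs₁, hf₁⟩ := h₁ p
  obtain ⟨u₂, ho₂, hp₂, k₂, s₂, hs₂, hf₂⟩ := h₂ p
  obtain ⟨hi, hV⟩ := diffAlong_iff.1 hV
  refine diffAlong_iff.2 ⟨hi, ?_⟩
  set F := Fin k₁ ⊕ Fin k₂ → ℝ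
  let c : Fin k₁ ⊕ Fin k₂ → M → E :=
    Sum.elim (fun a q ↦ comps (i p) (i q) (s₁ a q)) (fun a q ↦ comps (i p) (i q) (s₂ a q))
  have hcd : ∀ a, MDifferentiableAt 𝓘(ℝ, E') 𝓘(ℝ, E) (c a) p := by
    rintro (a | a)
    · exact (diffAlong_iff.1 (((hs₁ a).contMDiffAt (ho₁.mem_nhds hp₁)).mdifferentiableAt
        (by decide))).2
    · exact (diffAlong_iff.1 (((hs₂ a).contMDiffAt (ho₂.mem_nhds hp₂)).mdifferentiableAt
        (by decide))).2
  -- `B q` is the matrix whose columns are the components of the joint frame at `q`. It is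
  -- differentiable at `p` and, the subbundles being complementary, invertible near `p`.
  let B : M → F →L[ℝ] E := fun q ↦
    ∑ a, (ContinuousLinearMap.proj (R := ℝ) (φ := fun _ : Fin k₁ ⊕ Fin k₂ ↦ ℝ) a).smulRight (c a q)
  have hBa : ∀ q x, B q x = ∑ a, x a • c a q := fun q x ↦ by
    simp only [B, sum_apply, ContinuousLinearMap.smulRight_apply]
    rfl
  have hBd : MDifferentiableAt 𝓘(ℝ, E') 𝓘(ℝ, F →L[ℝ] E) B p := by
    refine mdifferentiableAt_fun_sum fun a _ ↦ ?_
    exact ((ContinuousLinearMap.smulRightL ℝ F E (ContinuousLinearMap.proj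
      (R := ℝ) (φ := fun _ : Fin k₁ ⊕ Fin k₂ ↦ ℝ) a)).differentiableAt).comp_mdifferentiableAt
        (hcd a)
  have hnear : ∀ᶠ q in 𝓝 p, q ∈ u₁ ∧ q ∈ u₂ ∧
      i q ∈ (trivializationAt E (TangentSpace 𝓘(ℝ, E) : N → Type _) (i p)).baseSet := by
    filter_upwards [ho₁.mem_nhds hp₁, ho₂.mem_nhds hp₂,
      hi.continuousAt.eventually (eventually_mem_baseSet (E := E) (i p))] with q h1 h2 h3
    exact ⟨h1, h2, h3⟩
  have hcq : ∀ q (hq : i q ∈ (trivializationAt E (TangentSpace 𝓘(ℝ, E) : N → Type _)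
      (i p)).baseSet) x, B q x = (trivializationAt E (TangentSpace 𝓘(ℝ, E) : N → Type _)
        (i p)).continuousLinearEquivAt ℝ (i q) hq
        (∑ a, x a • Sum.elim (fun a ↦ s₁ a q) (fun a ↦ s₂ a q) a) := by
    intro q hq x
    rw [hBa, map_sum]
    refine Finset.sum_congr rfl fun a _ ↦ ?_
    rw [map_smul]
    rcases a with a | a <;> simp only [c, Sum.elim_inl, Sum.elim_inr, comps_eq_equiv hq]
  have hbij : ∀ q, q ∈ u₁ ∧ q ∈ u₂ ∧
      i q ∈ (trivializationAt E (TangentSpace 𝓘(ℝ, E) : N → Type _) (i p)).baseSet →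
      ∃ b : F ≃L[ℝ] E, (b : F →L[ℝ] E) = B q := by
    rintro q ⟨hq₁, hq₂, hq⟩
    obtain ⟨hl₁, hw₁⟩ := hf₁ q hq₁
    obtain ⟨hl₂, hw₂⟩ := hf₂ q hq₂
    have hl := hl₁.sum_type hl₂ (by rw [hw₁, hw₂]; exact (hc q).disjoint)
    have hs : Submodule.span ℝ (Set.range (Sum.elim (fun a ↦ s₁ a q) (fun a ↦ s₂ a q))) = ⊤ := by
      rw [Set.Sum.elim_range, Submodule.span_union, hw₁, hw₂]
      exact (hc q).sup_eq_top
    let bas := Module.Basis.mk hl hs.ge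
    let eq := bas.equivFun.symm.trans ((trivializationAt E (TangentSpace 𝓘(ℝ, E) : N → Type _)
        (i p)).continuousLinearEquivAt ℝ (i q) hq).toLinearEquiv
    refine ⟨eq.toContinuousLinearEquiv, ?_⟩
    ext1 x
    rw [hcq q hq]
    have h : bas.equivFun.symm x = ∑ a, x a • Sum.elim (fun a ↦ s₁ a q) (fun a ↦ s₂ a q) a := by
      rw [Module.Basis.equivFun_symm_apply]
      simp only [bas, Module.Basis.mk_apply]
    rw [← h]
    rfl
  obtain ⟨b, hb⟩ := hbij p hnear.self_of_nhds
  have hinv : MDifferentiableAt 𝓘(ℝ, E') 𝓘(ℝ, E →L[ℝ] F)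
      (fun q ↦ ContinuousLinearMap.inverse (B q)) p := by
    have h := (contDiffAt_map_inverse (n := 1) b).differentiableAt one_ne_zero
    rw [hb] at h
    exact h.comp_mdifferentiableAt hBd
  have hx := hinv.clm_apply hV
  -- Solving with the inverse of `B` gives differentiable frame coefficients of the sum; keeping
  -- those of the first frame recovers `V₁`.
  have hres : MDifferentiableAt 𝓘(ℝ, E') 𝓘(ℝ, E) (fun q ↦ ∑ a : Fin k₁,
      (ContinuousLinearMap.inverse (B q) (comps (i p) (i q) (V₁ q + V₂ q))) (Sum.inl a)
        • c (Sum.inl a) q) p := by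
    refine mdifferentiableAt_fun_sum fun a _ ↦ ?_
    refine MDifferentiableAt.smul ?_ (hcd _)
    exact (ContinuousLinearMap.proj (R := ℝ) (φ := fun _ : Fin k₁ ⊕ Fin k₂ ↦ ℝ)
      (Sum.inl a)).differentiableAt.comp_mdifferentiableAt hx
  refine hres.congr_of_eventuallyEq ?_
  filter_upwards [hnear] with q hq
  obtain ⟨b, hb⟩ := hbij q hq
  obtain ⟨hq₁, hq₂, hq⟩ := hq
  obtain ⟨x₁, hx₁⟩ := (Submodule.mem_span_range_iff_exists_fun ℝ).1
    ((hf₁ q hq₁).2.symm ▸ hV₁ q : V₁ q ∈ Submodule.span ℝ (Set.range fun a ↦ s₁ a q))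
  obtain ⟨x₂, hx₂⟩ := (Submodule.mem_span_range_iff_exists_fun ℝ).1
    ((hf₂ q hq₂).2.symm ▸ hV₂ q : V₂ q ∈ Submodule.span ℝ (Set.range fun a ↦ s₂ a q))
  have h : comps (i p) (i q) (V₁ q + V₂ q) = b (Sum.elim x₁ x₂ : F) := by
    have h' := hcq q hq (Sum.elim x₁ x₂)
    rw [← hb] at h'
    rw [comps_eq_equiv hq, ← hx₁, ← hx₂]
    simpa using h'.symm
  rw [← hb, h, ContinuousLinearMap.inverse_equiv, ContinuousLinearEquiv.coe_coe,
    ContinuousLinearEquiv.symm_apply_apply, ← hx₁, comps_eq_equiv hq, map_sum]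
  refine Finset.sum_congr rfl fun a _ ↦ ?_
  rw [map_smul, ← comps_eq_equiv hq]
  rfl

end Frames

/-! ### The nearly Sasakian identity along an immersion. -/

section Fields

variable {E : Type*} [NormedAddCommGroup E] [NormedSpace ℝ E]
  {N : Type*} [TopologicalSpace N] [ChartedSpace E N] [IsManifold 𝓘(ℝ, E) ∞ N]
  {E' : Type*} [NormedAddCommGroup E'] [NormedSpace ℝ E']
  {M : Type*} [TopologicalSpace M] [ChartedSpace E' M]

theorem diffAlong_push [IsManifold 𝓘(ℝ, E') ∞ M] {i : M → N} (hi : ContMDiff 𝓘(ℝ, E') 𝓘(ℝ, E) ∞ i)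
    {X : ∀ p : M, TangentSpace 𝓘(ℝ, E') p} (hX : SmoothField (E' := E') X) (p : M) :
    DiffAlong E' i (push (E := E) i X) p := by
  have h := (hi.contMDiff_tangentMap (m := 1) (by decide)).comp (hX.of_le (by decide))
  exact (h p).mdifferentiableAt one_ne_zero

variable {g : SemiRiemannianMetric E N} (c : AlmostContactMetric g)

theorem AlmostContactMetric.mdifferentiableAt_φ (x₀ : N) :
    MDifferentiableAt 𝓘(ℝ, E) (𝓘(ℝ, E).prod 𝓘(ℝ, E →L[ℝ] E))
      (fun x : N ↦ TotalSpace.mk' (E →L[ℝ] E)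
        (E := fun x : N ↦ TangentSpace 𝓘(ℝ, E) x →L[ℝ] TangentSpace 𝓘(ℝ, E) x) x (c.φ x)) x₀ :=
  (c.smooth_φ x₀).mdifferentiableAt (by decide)

theorem DiffAlong.φ {i : M → N} {V : ∀ p : M, TangentSpace 𝓘(ℝ, E) (i p)} {p : M}
    (hV : DiffAlong E' i V p) : DiffAlong E' i (fun q ↦ c.φ (i q) (V q)) p := by
  have h := (c.mdifferentiableAt_φ (i p)).comp p (diffAlong_iff.1 hV).1
  exact MDifferentiableAt.clm_bundle_apply h hV

/-- The nearly Sasakian identity for vector fields tangent to an immersed submanifold. -/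
theorem IsNearlySasakian.covAlong [FiniteDimensional ℝ E]
    {nabla : CovariantDerivative 𝓘(ℝ, E) E (TangentSpace 𝓘(ℝ, E) : N → Type _)} {c : AlmostContactMetric g}
    {μ : ℝ} (hμ : IsNearlySasakian c nabla μ) {i : M → N}
    {X Y : ∀ p : M, TangentSpace 𝓘(ℝ, E') p} {p : M}
    (hX : DiffAlong E' i (push (E := E) i X) p) (hY : DiffAlong E' i (push (E := E) i Y) p) :
    covAlong nabla i (phiPush c i Y) p (X p) + covAlong nabla i (phiPush c i X) p (Y p)
      = c.φ (i p) (covAlong nabla i (push i Y) p (X p) + covAlong nabla i (push i X) p (Y p))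
        + μ • ((2 * g.val (i p) (push i X p) (push i Y p)) • c.ξ (i p)
          - c.η (i p) (push i Y p) • push i X p - c.η (i p) (push i X p) • push i Y p) := by
  have hb := mem_baseSet_trivializationAt E (TangentSpace 𝓘(ℝ, E) : N → Type _) (i p)
  -- The ambient hypothesis needs fields on `N`, and `X`, `Y` live only on `M`; constant-component
  -- extensions of their values at `p` suffice, since `covAlong_endo` expresses the derivatives
  -- along `i` through them.
  have h := hμ (constField (i p) (comps (i p) (i p) (push i X p)))
    (constField (i p) (comps (i p) (i p) (push i Y p))) (i p)
    (mdifferentiableAt_constField _ _) (mdifferentiableAt_constField _ _)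
  rw [← covAlong_endo nabla (c.mdifferentiableAt_φ (i p)) hY (X p)
      (constField_comps hb (push i X p)),
    ← covAlong_endo nabla (c.mdifferentiableAt_φ (i p)) hX (Y p)
      (constField_comps hb (push i Y p)),
    constField_comps hb, constField_comps hb] at h
  rw [← h, map_add]
  unfold phiPush
  abel

end Fields

/-! ### Linear algebra of orthogonal complements and of `φ`. -/

section Pointwise

variable {E : Type*} [NormedAddCommGroup E] [NormedSpace ℝ E]
  {N : Type*} [TopologicalSpace N] [ChartedSpace E N] [IsManifold 𝓘(ℝ, E) ∞ N]

namespace SemiRiemannianMetric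

variable (g : SemiRiemannianMetric E N) {x : N}

theorem orth_anti {U W : Submodule ℝ (TangentSpace 𝓘(ℝ, E) x)} (h : U ≤ W) :
    g.orth W ≤ g.orth U :=
  fun _ hv w hw ↦ hv w (h hw)

theorem le_orth_symm {U W : Submodule ℝ (TangentSpace 𝓘(ℝ, E) x)} (h : U ≤ g.orth W) :
    W ≤ g.orth U :=
  fun w hw u hu ↦ (g.symm x w u).trans (h hu w hw)

theorem mem_orth_sup {U W : Submodule ℝ (TangentSpace 𝓘(ℝ, E) x)} {v : TangentSpace 𝓘(ℝ, E) x}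
    (hU : v ∈ g.orth U) (hW : v ∈ g.orth W) : v ∈ g.orth (U ⊔ W) := by
  intro w hw
  obtain ⟨a, ha, b, hb, rfl⟩ := Submodule.mem_sup.1 hw
  rw [map_add, hU a ha, hW b hb, add_zero]

theorem NondegenerateOn.eq_zero {g : SemiRiemannianMetric E N}
    {W : Submodule ℝ (TangentSpace 𝓘(ℝ, E) x)} (hW : g.NondegenerateOn W)
    {v : TangentSpace 𝓘(ℝ, E) x} (hv : v ∈ W) (h : v ∈ g.orth W) : v = 0 :=
  Submodule.disjoint_def.1 hW v hv h

/-- If `g` pairs two subspaces `U` and `W` perfectly, then every vector acts on `W` as a vector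
of `U`. -/
theorem exists_mem_forall_eq [FiniteDimensional ℝ E] {U W : Submodule ℝ (TangentSpace 𝓘(ℝ, E) x)}
    (hU : Disjoint U (g.orth W)) (hW : Disjoint W (g.orth U)) (v : TangentSpace 𝓘(ℝ, E) x) :
    ∃ u ∈ U, ∀ w ∈ W, g.val x u w = g.val x v w := by
  have : FiniteDimensional ℝ (TangentSpace 𝓘(ℝ, E) x) := inferInstanceAs (FiniteDimensional ℝ E)
  let B : U →ₗ[ℝ] W →ₗ[ℝ] ℝ := LinearMap.mk₂ ℝ (fun u w ↦ g.val x u w)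
    (by intros; simp) (by intros; simp) (by intros; simp) (by intros; simp)
  have hB : B.IsPerfPair := by
    refine LinearMap.IsPerfPair.of_injective ?_ ?_
    · rw [injective_iff_map_eq_zero]
      intro u hu
      exact Subtype.ext (Submodule.disjoint_def.1 hU u u.2
        fun w hw ↦ LinearMap.congr_fun hu ⟨w, hw⟩)
    · rw [injective_iff_map_eq_zero]
      intro w hw
      refine Subtype.ext (Submodule.disjoint_def.1 hW w w.2 fun u hu ↦ ?_)
      rw [g.symm]
      exact LinearMap.congr_fun hw ⟨u, hu⟩
  obtain ⟨u, hu⟩ := hB.bijective_left.surjective ((g.val x v).toLinearMap ∘ₗ W.subtype)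
  exact ⟨u, u.2, fun w hw ↦ LinearMap.congr_fun hu ⟨w, hw⟩⟩

theorem finrank_add_finrank_orth [FiniteDimensional ℝ E]
    (W : Submodule ℝ (TangentSpace 𝓘(ℝ, E) x)) :
    Module.finrank ℝ W + Module.finrank ℝ (g.orth W)
      = Module.finrank ℝ (TangentSpace 𝓘(ℝ, E) x) := by
  have : FiniteDimensional ℝ (TangentSpace 𝓘(ℝ, E) x) := inferInstanceAs (FiniteDimensional ℝ E)
  let B : LinearMap.BilinForm ℝ (TangentSpace 𝓘(ℝ, E) x) :=
    LinearMap.mk₂ ℝ (fun u w ↦ g.val x u w)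
      (by intros; simp) (by intros; simp) (by intros; simp) (by intros; simp)
  have hr : B.IsRefl := fun u w h ↦ (g.symm x w u).trans h
  have hn : B.Nondegenerate := by
    refine hr.nondegenerate_iff_separatingLeft.2 ?_
    exact fun u hu ↦ g.nondegenerate x u hu
  have ho : B.orthogonal W = g.orth W := by
    ext v
    exact ⟨fun h w hw ↦ (g.symm x v w).trans (h w hw), fun h w hw ↦ (g.symm x w v).trans (h w hw)⟩
  rw [← ho, LinearMap.BilinForm.finrank_orthogonal hn]
  have := Submodule.finrank_le W
  omega

end SemiRiemannianMetric

namespace AlmostContactMetric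

variable {g : SemiRiemannianMetric E N} (c : AlmostContactMetric g) {x : N}

theorem mem_phiImage {W : Submodule ℝ (TangentSpace 𝓘(ℝ, E) x)} {v : TangentSpace 𝓘(ℝ, E) x}
    (hv : v ∈ W) : c.φ x v ∈ c.phiImage W :=
  Submodule.mem_map_of_mem hv

theorem val_φ_φ {v : TangentSpace 𝓘(ℝ, E) x} (hv : c.η x v = 0) (w : TangentSpace 𝓘(ℝ, E) x) :
    g.val x (c.φ x v) (c.φ x w) = g.val x v w := by
  rw [c.metric_φ, hv, zero_mul, sub_zero]

theorem φ_φ_of_η_eq_zero {v : TangentSpace 𝓘(ℝ, E) x} (hv : c.η x v = 0) :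
    c.φ x (c.φ x v) = -v := by
  rw [c.φ_φ, hv, zero_smul, add_zero]

/-- `φ` is skew-symmetric. -/
theorem val_φ_left (v w : TangentSpace 𝓘(ℝ, E) x) :
    g.val x (c.φ x v) w = -g.val x v (c.φ x w) := by
  have h := c.metric_φ x v (c.φ x w)
  rw [c.φ_φ, c.η_φ, mul_zero, sub_zero, map_add, map_neg, map_smul, g.symm x _ (c.ξ x),
    ← c.η_eq, c.η_φ, smul_zero, add_zero] at h
  linarith

theorem mem_orth_lineξ {v : TangentSpace 𝓘(ℝ, E) x} :
    v ∈ g.orth (c.lineξ x) ↔ c.η x v = 0 := by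
  refine ⟨fun h ↦ ?_, fun h w hw ↦ ?_⟩
  · rw [c.η_eq, g.symm]
    exact h _ (Submodule.mem_span_singleton_self _)
  · obtain ⟨a, rfl⟩ := Submodule.mem_span_singleton.1 hw
    rw [map_smul, g.symm, ← c.η_eq, h, smul_zero]

end AlmostContactMetric

end Pointwise

/-! ### The decomposition of the ambient tangent space into `TM` and `tr(TM)`. -/

section Submanifold

variable {E : Type*} [NormedAddCommGroup E] [NormedSpace ℝ E]
  {N : Type*} [TopologicalSpace N] [ChartedSpace E N] [IsManifold 𝓘(ℝ, E) ∞ N]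
  {E' : Type*} [NormedAddCommGroup E'] [NormedSpace ℝ E']
  {M : Type*} [TopologicalSpace M] [ChartedSpace E' M]

namespace LightlikeSubmanifold

variable {g : SemiRiemannianMetric E N} {i : M → N} {r : ℕ} (A : LightlikeSubmanifold E' g i r)
  (p : M)

theorem screen_le : A.screen p ≤ tangentSub E' i p :=
  le_sup_right.trans (A.rad_sup_screen p).le

theorem screenTr_le_orth : A.screenTr p ≤ g.orth (tangentSub E' i p) :=
  le_sup_right.trans (A.rad_sup_screenTr p).le

theorem tr_le_orth_screen : A.tr p ≤ g.orth (A.screen p) :=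
  sup_le (A.ltr_orth_screen p) ((A.screenTr_le_orth p).trans (g.orth_anti (A.screen_le p)))

theorem tangentSub_le_orth_rad : tangentSub E' i p ≤ g.orth (rad E' g i p) :=
  g.le_orth_symm inf_le_right

theorem screenTr_le_orth_rad : A.screenTr p ≤ g.orth (rad E' g i p) :=
  (A.screenTr_le_orth p).trans (g.orth_anti inf_le_left)

theorem tanPart_add_trPart {p : M} (v : TangentSpace 𝓘(ℝ, E) (i p)) :
    mfderiv 𝓘(ℝ, E') 𝓘(ℝ, E) i p (A.tanPart p v) + A.trPart p v = v := by
  rw [trPart]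
  abel

theorem sub_trPart_mem {p : M} (v : TangentSpace 𝓘(ℝ, E) (i p)) :
    v - A.trPart p v ∈ tangentSub E' i p :=
  ⟨A.tanPart p v, by rw [trPart]; simp⟩

theorem isSmoothSubbundle_tangentSub (A : LightlikeSubmanifold E' g i r) :
    IsSmoothSubbundle E' i (tangentSub (E := E) E' i) := by
  have h := A.smooth_rad.sup A.smooth_screen A.rad_disjoint_screen
  simpa only [A.rad_sup_screen] using h

variable [FiniteDimensional ℝ E]

/-- In a basis dual to one of the radical, the coordinates of a vector of `ltr` are its products
with the radical basis. -/
theorem disjoint_ltr_orth_rad : Disjoint (A.ltr p) (g.orth (rad E' g i p)) := by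
  have : FiniteDimensional ℝ (TangentSpace 𝓘(ℝ, E) (i p)) :=
    inferInstanceAs (FiniteDimensional ℝ E)
  refine Submodule.disjoint_def.2 fun l hl h ↦ ?_
  let e := Module.finBasisOfFinrankEq ℝ (rad E' g i p) (A.finrank_rad p)
  obtain ⟨n, hn⟩ := A.ltr_dual p e
  have hs : l = ∑ b, n.repr ⟨l, hl⟩ b • (n b : TangentSpace 𝓘(ℝ, E) (i p)) := by
    have h := congrArg (A.ltr p).subtype (n.sum_repr ⟨l, hl⟩)
    rw [map_sum] at h
    exact h.symm
  rw [hs]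
  refine Finset.sum_eq_zero fun a _ ↦ ?_
  have h0 := h (e a) (e a).2
  rw [g.symm, hs, map_sum] at h0
  simp only [map_smul, hn] at h0
  simp at h0
  rw [h0, zero_smul]

theorem finrank_ltr : Module.finrank ℝ (A.ltr p) = r := by
  have : FiniteDimensional ℝ (TangentSpace 𝓘(ℝ, E) (i p)) :=
    inferInstanceAs (FiniteDimensional ℝ E)
  obtain ⟨n, -⟩ := A.ltr_dual p (Module.finBasisOfFinrankEq ℝ (rad E' g i p) (A.finrank_rad p))
  rw [Module.finrank_eq_card_basis n, Fintype.card_fin]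

theorem disjoint_ltr_screenTr : Disjoint (A.ltr p) (A.screenTr p) :=
  (A.disjoint_ltr_orth_rad p).mono_right (A.screenTr_le_orth_rad p)

/-- Tangent vectors and `S(TM^⊥)` are orthogonal to the radical, which kills the `ltr` part; what
remains is tangent and normal, hence in the radical, which meets `S(TM^⊥)` trivially. -/
theorem disjoint_tangentSub_tr : Disjoint (tangentSub E' i p) (A.tr p) := by
  refine Submodule.disjoint_def.2 fun v hv h ↦ ?_
  obtain ⟨l, hl, t, ht, rfl⟩ := Submodule.mem_sup.1 h
  have hl0 : l = 0 := by
    refine Submodule.disjoint_def.1 (A.disjoint_ltr_orth_rad p) l hl ?_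
    have := sub_mem (tangentSub_le_orth_rad (g := g) p hv) (A.screenTr_le_orth_rad p ht)
    simpa using this
  subst hl0
  rw [zero_add] at hv ⊢
  exact Submodule.disjoint_def.1 (A.rad_disjoint_screenTr p) t ⟨hv, A.screenTr_le_orth p ht⟩ ht

/-- `T_{i p} N = T_p M ⊕ tr(TM)_p`. -/
theorem isCompl_tangentSub_tr : IsCompl (tangentSub E' i p) (A.tr p) := by
  have : FiniteDimensional ℝ (TangentSpace 𝓘(ℝ, E) (i p)) :=
    inferInstanceAs (FiniteDimensional ℝ E)
  refine ⟨A.disjoint_tangentSub_tr p, codisjoint_iff.2 ?_⟩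
  -- The radical and `ltr` both have rank `r`, so `tr(TM)` has the dimension of `TM^⊥`, which is
  -- complementary to that of `TM`.
  apply Submodule.eq_top_of_finrank_eq
  have h1 := Submodule.finrank_sup_add_finrank_inf_eq (tangentSub E' i p) (A.tr p)
  have h2 : Module.finrank ℝ (A.tr p) + _ = _ :=
    Submodule.finrank_sup_add_finrank_inf_eq (A.ltr p) (A.screenTr p)
  have h3 := Submodule.finrank_sup_add_finrank_inf_eq (rad E' g i p) (A.screenTr p)
  have h4 := g.finrank_add_finrank_orth (tangentSub E' i p)
  rw [(A.disjoint_tangentSub_tr p).eq_bot, finrank_bot] at h1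
  rw [(A.disjoint_ltr_screenTr p).eq_bot, finrank_bot, A.finrank_ltr] at h2
  rw [(A.rad_disjoint_screenTr p).eq_bot, finrank_bot, A.finrank_rad, A.rad_sup_screenTr] at h3
  omega

variable {p}

/-- Since the sum is all of `T_{i p} N`, the default value `0` in `tanPart` is never reached. -/
theorem trPart_mem (v : TangentSpace 𝓘(ℝ, E) (i p)) : A.trPart p v ∈ A.tr p := by
  have h : ∃ u : TangentSpace 𝓘(ℝ, E') p, v - mfderiv 𝓘(ℝ, E') 𝓘(ℝ, E) i p u ∈ A.tr p := by
    obtain ⟨t, ⟨u, rfl⟩, n, hn, rfl⟩ := Submodule.mem_sup.1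
      ((A.isCompl_tangentSub_tr p).sup_eq_top ▸ Submodule.mem_top :
        v ∈ tangentSub E' i p ⊔ A.tr p)
    exact ⟨u, by simpa using hn⟩
  rw [trPart, tanPart, dif_pos h]
  exact h.choose_spec

theorem trPart_eq {v n : TangentSpace 𝓘(ℝ, E) (i p)} (hn : n ∈ A.tr p)
    (h : v - n ∈ tangentSub E' i p) : A.trPart p v = n := by
  refine sub_eq_zero.1 (Submodule.disjoint_def.1 (A.disjoint_tangentSub_tr p) _ ?_
    (sub_mem (A.trPart_mem v) hn))
  have : A.trPart p v - n = (v - n) - mfderiv 𝓘(ℝ, E') 𝓘(ℝ, E) i p (A.tanPart p v) := by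
    rw [trPart]
    abel
  rw [this]
  exact sub_mem h ⟨_, rfl⟩

theorem trPart_add (v w : TangentSpace 𝓘(ℝ, E) (i p)) :
    A.trPart p (v + w) = A.trPart p v + A.trPart p w := by
  refine A.trPart_eq (add_mem (A.trPart_mem v) (A.trPart_mem w)) ?_
  rw [add_sub_add_comm]
  exact add_mem (A.sub_trPart_mem v) (A.sub_trPart_mem w)

theorem trPart_of_mem_tangentSub {v : TangentSpace 𝓘(ℝ, E) (i p)} (hv : v ∈ tangentSub E' i p) :
    A.trPart p v = 0 :=
  A.trPart_eq (zero_mem _) (by simpa using hv)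

theorem trPart_of_mem_tr {v : TangentSpace 𝓘(ℝ, E) (i p)} (hv : v ∈ A.tr p) :
    A.trPart p v = v :=
  A.trPart_eq hv (by simp)

end LightlikeSubmanifold

end Submanifold

/-! ### The transversal splitting and the action of `φ` on it. -/

section QGCR

variable {E : Type*} [NormedAddCommGroup E] [NormedSpace ℝ E]
  {N : Type*} [TopologicalSpace N] [ChartedSpace E N] [IsManifold 𝓘(ℝ, E) ∞ N]
  {E' : Type*} [NormedAddCommGroup E'] [NormedSpace ℝ E']
  {M : Type*} [TopologicalSpace M] [ChartedSpace E' M]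
  {g : SemiRiemannianMetric E N} {c : AlmostContactMetric g} {i : M → N} {r : ℕ}
  {A : LightlikeSubmanifold E' g i r}

namespace LightlikeSubmanifold.QGCR

variable (Q : A.QGCR c) {p : M}

theorem D₂_le_rad : Q.D₂ p ≤ rad E' g i p := le_sup_right.trans (Q.D₁_sup_D₂ p).le

theorem D₁_le_rad : Q.D₁ p ≤ rad E' g i p := le_sup_left.trans (Q.D₁_sup_D₂ p).le

theorem φ_S_le : c.phiImage (Q.S p) ≤ A.screen p :=
  le_trans (le_trans le_sup_left (le_trans le_sup_right le_sup_left)) (Q.screen_eq p).le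

theorem φ_L_le : c.phiImage (Q.L p) ≤ A.screen p :=
  le_trans (le_trans le_sup_right (le_trans le_sup_right le_sup_left)) (Q.screen_eq p).le

theorem D₀_le : Q.D₀ p ≤ A.screen p := le_sup_right.trans (Q.screen_eq p).le

theorem L_le_orth_tr : Q.L p ≤ g.orth (A.tr p) := fun _ hl ↦
  g.mem_orth_sup (A.ltr_null p (Q.L_le p hl)) (A.ltr_orth_screenTr p (Q.L_le p hl))

theorem S_le_orth_D₂ : Q.S p ≤ g.orth (Q.D₂ p) :=
  (Q.S_le p).trans ((A.screenTr_le_orth_rad p).trans (g.orth_anti Q.D₂_le_rad))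

theorem L_le_tr : Q.L p ≤ A.tr p := (Q.L_le p).trans le_sup_left

theorem S_le_tr : Q.S p ≤ A.tr p := (Q.S_le p).trans le_sup_right

theorem η_eq_zero_of_mem_G {v : TangentSpace 𝓘(ℝ, E) (i p)} (hv : v ∈ Q.G p) :
    c.η (i p) v = 0 :=
  c.mem_orth_lineξ.1 hv.2

/-- A vector with `φ v` in the complement of `D₀` in the screen and orthogonal to `D₂`, `S` and `L`
vanishes. -/
theorem eq_zero_of_mem_orth {v : TangentSpace 𝓘(ℝ, E) (i p)} (hη : c.η (i p) v = 0)
    (hv : c.φ (i p) v ∈ c.phiImage (Q.D₂ p) ⊔ (c.phiImage (Q.S p) ⊔ c.phiImage (Q.L p)))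
    (h₂ : v ∈ g.orth (Q.D₂ p)) (hS : v ∈ g.orth (Q.S p)) (hL : v ∈ g.orth (Q.L p)) : v = 0 := by
  have key : ∀ W : Submodule ℝ (TangentSpace 𝓘(ℝ, E) (i p)), v ∈ g.orth W →
      c.φ (i p) v ∈ g.orth (c.phiImage W) := by
    rintro W hW _ ⟨w, hw, rfl⟩
    exact (c.val_φ_φ hη w).trans (hW w hw)
  -- `φ v` lies in the screen and is orthogonal to every summand of it: to the `φ`-images because
  -- `φ` preserves products with a vector killed by `η`, to `D₀` because that summand is orthogonal
  -- to the others.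
  have h0 : c.φ (i p) v = 0 := by
    refine (A.screen_nondegenerate p).eq_zero (Q.screen_eq p ▸ Submodule.mem_sup_left hv) ?_
    rw [← Q.screen_eq p]
    exact g.mem_orth_sup (g.mem_orth_sup (key _ h₂) (g.mem_orth_sup (key _ hS) (key _ hL)))
      (g.le_orth_symm (Q.D₀_orth p) hv)
  have := c.φ_φ_of_η_eq_zero hη
  rwa [h0, map_zero, eq_comm, neg_eq_zero] at this

namespace IsCoScreen

variable {Q} (hQ : Q.IsCoScreen)
include hQ

theorem η_eq_zero_of_mem_tangentSub {v : TangentSpace 𝓘(ℝ, E) (i p)}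
    (hv : v ∈ tangentSub E' i p) : c.η (i p) v = 0 := by
  rw [c.η_eq]
  exact A.screenTr_le_orth p (hQ.ξ_mem p) v hv

/-- The condition `φ D̄ = S ⊥ L` enters here: these vectors are values of `φ`, and `η ∘ φ = 0`. -/
theorem η_eq_zero_of_mem_S_sup_L {v : TangentSpace 𝓘(ℝ, E) (i p)} (hv : v ∈ Q.S p ⊔ Q.L p) :
    c.η (i p) v = 0 := by
  rw [← hQ.phi_Dbar p] at hv
  obtain ⟨w, -, rfl⟩ := hv
  exact c.η_φ _ _

theorem η_eq_zero_of_mem_S {v : TangentSpace 𝓘(ℝ, E) (i p)} (hv : v ∈ Q.S p) :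
    c.η (i p) v = 0 :=
  hQ.η_eq_zero_of_mem_S_sup_L (Submodule.mem_sup_left hv)

theorem η_eq_zero_of_mem_L {v : TangentSpace 𝓘(ℝ, E) (i p)} (hv : v ∈ Q.L p) :
    c.η (i p) v = 0 :=
  hQ.η_eq_zero_of_mem_S_sup_L (Submodule.mem_sup_right hv)

theorem η_eq_zero_of_mem_D₂ {v : TangentSpace 𝓘(ℝ, E) (i p)} (hv : v ∈ Q.D₂ p) :
    c.η (i p) v = 0 :=
  hQ.η_eq_zero_of_mem_tangentSub (Q.D₂_le_rad hv).1

theorem lineξ_le_screenTr : c.lineξ (i p) ≤ A.screenTr p := by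
  rw [AlmostContactMetric.lineξ, Submodule.span_singleton_le_iff_mem]
  exact hQ.ξ_mem p

theorem ξ_mem_tr : c.ξ (i p) ∈ A.tr p := Submodule.mem_sup_right (hQ.ξ_mem p)

/-- `L` is already orthogonal to all of `tr(TM)`, so `D₂` alone must detect it. With
`disjoint_D₂_orth_L` this makes the pairing of `L` and `D₂` perfect. -/
theorem disjoint_L_orth_D₂ : Disjoint (Q.L p) (g.orth (Q.D₂ p)) :=
  Submodule.disjoint_def.2 fun _ hl h ↦ Q.eq_zero_of_mem_orth (hQ.η_eq_zero_of_mem_L hl)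
    (Submodule.mem_sup_right (Submodule.mem_sup_right (c.mem_phiImage hl))) h
    (g.orth_anti Q.S_le_tr (Q.L_le_orth_tr hl)) (g.orth_anti Q.L_le_tr (Q.L_le_orth_tr hl))

theorem disjoint_D₂_orth_L : Disjoint (Q.D₂ p) (g.orth (Q.L p)) :=
  Submodule.disjoint_def.2 fun _ hd h ↦ Q.eq_zero_of_mem_orth (hQ.η_eq_zero_of_mem_D₂ hd)
    (Submodule.mem_sup_left (c.mem_phiImage hd))
    (g.orth_anti (Q.D₂_le_rad.trans inf_le_left) (Q.D₂_le_rad hd).2)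
    (g.le_orth_symm Q.S_le_orth_D₂ hd) h

theorem disjoint_S_orth_S : Disjoint (Q.S p) (g.orth (Q.S p)) :=
  Submodule.disjoint_def.2 fun _ hs h ↦ Q.eq_zero_of_mem_orth (hQ.η_eq_zero_of_mem_S hs)
    (Submodule.mem_sup_right (Submodule.mem_sup_left (c.mem_phiImage hs)))
    (Q.S_le_orth_D₂ hs) h (g.le_orth_symm Q.L_le_orth_tr (Q.S_le_tr hs) )

theorem lineξ_le_orth_S : c.lineξ (i p) ≤ g.orth (Q.S p) :=
  g.le_orth_symm fun _ hs ↦ c.mem_orth_lineξ.2 (hQ.η_eq_zero_of_mem_S hs)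

theorem lineξ_le_orth_D₂ : c.lineξ (i p) ≤ g.orth (Q.D₂ p) :=
  g.le_orth_symm fun _ hd ↦ c.mem_orth_lineξ.2 (hQ.η_eq_zero_of_mem_D₂ hd)

/-- Take `l ∈ L` with the same products with `D₂` as `v`, `s ∈ S` with the same products with `S`,
and `z = η(v) ξ`. The cross terms vanish, so each correction leaves the other conditions intact and
the remainder lies in `G`. -/
theorem tr_le_sup [FiniteDimensional ℝ E] :
    A.tr p ≤ (Q.L p ⊔ Q.S p) ⊔ (Q.G p ⊔ c.lineξ (i p)) := by
  intro v hv
  obtain ⟨l, hl, hlv⟩ := g.exists_mem_forall_eq hQ.disjoint_L_orth_D₂ hQ.disjoint_D₂_orth_L v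
  obtain ⟨s, hs, hsv⟩ := g.exists_mem_forall_eq (hQ.disjoint_S_orth_S (p := p))
    hQ.disjoint_S_orth_S v
  set z := c.η (i p) v • c.ξ (i p) with hz
  have hzξ : z ∈ c.lineξ (i p) := Submodule.smul_mem _ _ (Submodule.mem_span_singleton_self _)
  have hG : v - l - s - z ∈ Q.G p := by
    refine ⟨⟨⟨?_, ?_⟩, ?_⟩, ?_⟩
    · exact sub_mem (sub_mem (sub_mem hv (Q.L_le_tr hl)) (Q.S_le_tr hs))
        (Submodule.smul_mem _ _ hQ.ξ_mem_tr)
    · intro d hd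
      simp only [map_sub, sub_apply]
      rw [hlv d hd, Q.S_le_orth_D₂ hs d hd, hQ.lineξ_le_orth_D₂ hzξ d hd]
      ring
    · intro w hw
      simp only [map_sub, sub_apply]
      rw [hsv w hw, Q.L_le_orth_tr hl w (Q.S_le_tr hw), hQ.lineξ_le_orth_S hzξ w hw]
      ring
    · rw [SetLike.mem_coe, c.mem_orth_lineξ, hz, map_sub, map_sub, map_sub, map_smul, c.η_ξ,
        hQ.η_eq_zero_of_mem_L hl, hQ.η_eq_zero_of_mem_S hs]
      simp
  have : v = (l + s) + ((v - l - s - z) + z) := by abel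
  rw [this]
  exact add_mem (Submodule.mem_sup_left (Submodule.add_mem_sup hl hs))
    (Submodule.mem_sup_right (Submodule.add_mem_sup hG hzξ))

/-- The splitting `tr(TM) = (L ⊥ S) ⊥ G ⊥ ℝξ`. -/
theorem isTransversalDecomposition [FiniteDimensional ℝ E] (p : M) :
    Q.IsTransversalDecomposition p (Q.G p) where
  sup_eq := by
    refine le_antisymm (sup_le (sup_le Q.L_le_tr Q.S_le_tr) (sup_le ?_ ?_)) hQ.tr_le_sup
    · exact fun v hv ↦ hv.1.1.1
    · exact hQ.lineξ_le_screenTr.trans le_sup_right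
  L_disjoint_S := hQ.disjoint_L_orth_D₂.mono_right Q.S_le_orth_D₂
  G_disjoint_ξ := by
    refine Submodule.disjoint_def.2 fun v hv h ↦ ?_
    obtain ⟨a, rfl⟩ := Submodule.mem_span_singleton.1 h
    have := Q.η_eq_zero_of_mem_G hv
    rw [map_smul, c.η_ξ, smul_eq_mul, mul_one] at this
    rw [this, zero_smul]
  disjoint := by
    refine Submodule.disjoint_def.2 fun v hv h ↦ ?_
    obtain ⟨l, hl, s, hs, rfl⟩ := Submodule.mem_sup.1 hv
    have h₂ : l + s ∈ g.orth (Q.D₂ p) :=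
      (sup_le (fun v hv ↦ hv.1.1.2) hQ.lineξ_le_orth_D₂ : Q.G p ⊔ c.lineξ (i p) ≤ _) h
    have hS : l + s ∈ g.orth (Q.S p) :=
      (sup_le (fun v hv ↦ hv.1.2) hQ.lineξ_le_orth_S : Q.G p ⊔ c.lineξ (i p) ≤ _) h
    have hl0 : l = 0 := Submodule.disjoint_def.1 hQ.disjoint_L_orth_D₂ l hl
      (by simpa using sub_mem h₂ (Q.S_le_orth_D₂ hs))
    subst hl0
    rw [zero_add] at hS ⊢
    exact Submodule.disjoint_def.1 hQ.disjoint_S_orth_S s hs hS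
  L_orth_S := Q.L_le_orth_tr.trans (g.orth_anti Q.S_le_tr)
  LS_orth_G := sup_le (Q.L_le_orth_tr.trans (g.orth_anti fun v hv ↦ hv.1.1.1))
    (g.le_orth_symm fun v hv ↦ hv.1.2)
  LS_orth_ξ := sup_le (fun _ hl ↦ c.mem_orth_lineξ.2 (hQ.η_eq_zero_of_mem_L hl))
    (fun _ hs ↦ c.mem_orth_lineξ.2 (hQ.η_eq_zero_of_mem_S hs))
  G_orth_ξ := fun v hv ↦ hv.2

/-- A splitting of `tr(TM)` with a `φ`-invariant third summand is the one given by `G`. -/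
theorem eq_G_of_phiImage_eq [FiniteDimensional ℝ E] {G' : Submodule ℝ (TangentSpace 𝓘(ℝ, E) (i p))}
    (h : Q.IsTransversalDecomposition p G') (hφ : c.phiImage G' = G') : G' = Q.G p := by
  have hG := hQ.isTransversalDecomposition p
  have htr : G' ≤ A.tr p := (le_sup_left.trans le_sup_right).trans h.sup_eq.le
  have hle : G' ≤ Q.G p := by
    refine fun v hv ↦ ⟨⟨⟨htr hv, fun d hd ↦ ?_⟩, ?_⟩, h.G_orth_ξ hv⟩
    · have hη := c.mem_orth_lineξ.1 (h.G_orth_ξ hv)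
      rw [← c.val_φ_φ hη]
      exact A.tr_le_orth_screen p (htr (hφ ▸ c.mem_phiImage hv)) _
        (Q.phi_D₂ p (c.mem_phiImage hd))
    · exact g.le_orth_symm (le_sup_right.trans h.LS_orth_G) hv
  -- Of two nested complements of the same subspace the smaller is everything: expanding `v ∈ G` in
  -- the splitting for `G'`, the parts in `L ⊥ S` and `ℝξ` vanish by directness of the splitting for
  -- `G`.
  refine le_antisymm hle fun v hv ↦ ?_
  obtain ⟨x, hx, y, hy, rfl⟩ := Submodule.mem_sup.1
    (h.sup_eq.ge (hv.1.1.1 : v ∈ A.tr p))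
  obtain ⟨w, hw, z, hz, rfl⟩ := Submodule.mem_sup.1 hy
  have hx0 : x = 0 := by
    refine Submodule.disjoint_def.1 hG.disjoint x hx ?_
    have := sub_mem (Submodule.mem_sup_left hv : _ ∈ Q.G p ⊔ c.lineξ (i p))
      (add_mem (Submodule.mem_sup_left (hle hw)) (Submodule.mem_sup_right hz))
    simpa using this
  subst hx0
  have hz0 : z = 0 := by
    refine Submodule.disjoint_def.1 hG.G_disjoint_ξ z ?_ hz
    have := sub_mem hv (hle hw)
    simpa using this
  subst hz0
  simpa using hw

/-- The one summand not covered by an axiom is `φ D₂`, where `φ² = -1` leads back to `D₂`. -/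
theorem φ_mem_tangentSub_of_mem_D {v : TangentSpace 𝓘(ℝ, E) (i p)} (hv : v ∈ Q.D p) :
    c.φ (i p) v ∈ tangentSub E' i p := by
  have h : Q.D p ≤ (tangentSub E' i p).comap (c.φ (i p)).toLinearMap := by
    refine sup_le (sup_le ?_ ?_) ?_
    · rw [← Q.D₁_sup_D₂ p]
      refine sup_le (fun v hv ↦ ?_) (fun v hv ↦ ?_)
      · exact (Q.D₁_le_rad (Q.phi_D₁ p ▸ c.mem_phiImage hv)).1
      · exact A.screen_le p (Q.phi_D₂ p (c.mem_phiImage hv))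
    · exact fun v hv ↦ A.screen_le p (Q.D₀_le (Q.phi_D₀ p (c.mem_phiImage hv)))
    · rintro _ ⟨v, hv, rfl⟩
      change c.φ (i p) (c.φ (i p) v) ∈ tangentSub E' i p
      rw [c.φ_φ_of_η_eq_zero (hQ.η_eq_zero_of_mem_D₂ hv)]
      exact neg_mem (Q.D₂_le_rad hv).1
  exact h hv

/-- `φ v` is orthogonal to the screen, so its tangential part is radical. Removing a radical vector
affects neither orthogonality to `D₂` and `S` nor the value of `η`. The argument leaves room for a
radical part, so only the transversal part is placed in `G`. -/
theorem trPart_φ_mem_of_mem_G [FiniteDimensional ℝ E] {v : TangentSpace 𝓘(ℝ, E) (i p)}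
    (hv : v ∈ Q.G p) : A.trPart p (c.φ (i p) v) ∈ Q.G p := by
  have hη := Q.η_eq_zero_of_mem_G hv
  have htr : v ∈ A.tr p := hv.1.1.1
  have hL : v ∈ g.orth (Q.L p) := g.le_orth_symm Q.L_le_orth_tr htr
  have hsc := A.tr_le_orth_screen p htr
  set n := A.trPart p (c.φ (i p) v) with hn
  have hntr : n ∈ A.tr p := A.trPart_mem _
  have key : ∀ W : Submodule ℝ (TangentSpace 𝓘(ℝ, E) (i p)), v ∈ g.orth W →
      c.φ (i p) v ∈ g.orth (c.phiImage W) := by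
    rintro W hW _ ⟨w, hw, rfl⟩
    exact (c.val_φ_φ hη w).trans (hW w hw)
  have hφsc : c.φ (i p) v ∈ g.orth (A.screen p) := by
    rw [← Q.screen_eq p]
    refine g.mem_orth_sup (g.mem_orth_sup (key _ hv.1.1.2)
      (g.mem_orth_sup (key _ hv.1.2) (key _ hL))) fun d hd ↦ ?_
    rw [c.val_φ_left, hsc _ (Q.D₀_le (Q.phi_D₀ p (c.mem_phiImage hd))), neg_zero]
  have hrad : c.φ (i p) v - n ∈ rad E' g i p := by
    obtain ⟨e, he, s, hs, hes⟩ := Submodule.mem_sup.1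
      ((A.rad_sup_screen p).ge (A.sub_trPart_mem (c.φ (i p) v)))
    have hs0 : s = 0 := by
      refine (A.screen_nondegenerate p).eq_zero hs ?_
      have h1 := sub_mem hφsc (A.tr_le_orth_screen p hntr)
      rw [← hn] at hes
      rw [← hes] at h1
      simpa using sub_mem h1 (g.orth_anti (A.screen_le p) he.2)
    rw [hn, ← hes, hs0, add_zero]
    exact he
  have hn_eq : n = c.φ (i p) v - (c.φ (i p) v - n) := by abel
  refine ⟨⟨⟨hntr, ?_⟩, ?_⟩, ?_⟩
  · rw [hn_eq]
    refine sub_mem (fun d hd ↦ ?_) (g.orth_anti (Q.D₂_le_rad.trans inf_le_left) hrad.2)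
    rw [c.val_φ_left, hsc _ (Q.phi_D₂ p (c.mem_phiImage hd)), neg_zero]
  · rw [hn_eq]
    refine sub_mem (fun s hs ↦ ?_) (g.le_orth_symm
      ((Q.S_le p).trans (A.screenTr_le_orth_rad p)) hrad)
    rw [c.val_φ_left, hsc _ (Q.φ_S_le (c.mem_phiImage hs)), neg_zero]
  · rw [hn_eq, SetLike.mem_coe, c.mem_orth_lineξ, map_sub, c.η_φ,
      hQ.η_eq_zero_of_mem_tangentSub hrad.1, sub_zero]

theorem trPart_φ_mem_G [FiniteDimensional ℝ E] {v w : TangentSpace 𝓘(ℝ, E) (i p)}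
    (hv : v ∈ Q.D p) (hw : w ∈ A.tr p) : A.trPart p (c.φ (i p) (v + w)) ∈ Q.G p := by
  obtain ⟨x, hx, y, hy, rfl⟩ := Submodule.mem_sup.1
    ((hQ.isTransversalDecomposition p).sup_eq.ge hw)
  obtain ⟨l, hl, s, hs, rfl⟩ := Submodule.mem_sup.1 hx
  obtain ⟨u, hu, z, hz, rfl⟩ := Submodule.mem_sup.1 hy
  obtain ⟨a, rfl⟩ := Submodule.mem_span_singleton.1 hz
  simp only [map_add, map_smul, c.φ_ξ, smul_zero, add_zero, A.trPart_add]
  rw [A.trPart_of_mem_tangentSub (hQ.φ_mem_tangentSub_of_mem_D hv),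
    A.trPart_of_mem_tangentSub (A.screen_le p (Q.φ_L_le (c.mem_phiImage hl))),
    A.trPart_of_mem_tangentSub (A.screen_le p (Q.φ_S_le (c.mem_phiImage hs))),
    zero_add, zero_add, zero_add]
  exact hQ.trPart_φ_mem_of_mem_G hu

end IsCoScreen

end LightlikeSubmanifold.QGCR

end QGCR

/-! ### The transversal field of a pair of vector fields. -/

section Main

variable {E : Type*} [NormedAddCommGroup E] [NormedSpace ℝ E] [FiniteDimensional ℝ E]
  {N : Type*} [TopologicalSpace N] [ChartedSpace E N] [IsManifold 𝓘(ℝ, E) ∞ N]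
  {E' : Type*} [NormedAddCommGroup E'] [NormedSpace ℝ E']
  {M : Type*} [TopologicalSpace M] [ChartedSpace E' M]
  {g : SemiRiemannianMetric E N} {c : AlmostContactMetric g} {i : M → N} {r : ℕ}
  (A : LightlikeSubmanifold E' g i r)

namespace LightlikeSubmanifold

theorem isSmoothSubbundle_tr : IsSmoothSubbundle E' i A.tr :=
  A.smooth_ltr.sup A.smooth_screenTr fun p ↦ A.disjoint_ltr_screenTr p

variable [IsManifold 𝓘(ℝ, E') ∞ M]

/-- Additivity of the derivative requires both components of `φ X` to be differentiable;
complementary smooth frames of `TM` and `tr(TM)` provide this. -/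
theorem covAlong_phiPush (nabla : CovariantDerivative 𝓘(ℝ, E) E (TangentSpace 𝓘(ℝ, E) : N → Type _))
    {X : ∀ p : M, TangentSpace 𝓘(ℝ, E') p} (hX : SmoothField X) (p : M)
    (v : TangentSpace 𝓘(ℝ, E') p) :
    covAlong nabla i (phiPush c i X) p v
      = covAlong nabla i (push i (A.phiTan c X)) p v + covAlong nabla i (A.phiTr c X) p v := by
  have hsum : ∀ q, push i (A.phiTan c X) q + A.phiTr c X q = phiPush c i X q :=
    fun q ↦ A.tanPart_add_trPart _
  have hd : DiffAlong E' i (phiPush c i X) p := (diffAlong_push A.smooth_i hX p).φ c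
  have h1 : DiffAlong E' i (fun q ↦ push i (A.phiTan c X) q + A.phiTr c X q) p := by
    simpa only [hsum] using hd
  have h2 : DiffAlong E' i (fun q ↦ A.phiTr c X q + push i (A.phiTan c X) q) p := by
    simpa only [add_comm] using h1
  have hT : ∀ q, push i (A.phiTan c X) q ∈ tangentSub (E := E) E' i q := fun q ↦ ⟨_, rfl⟩
  have hN : ∀ q, A.phiTr c X q ∈ A.tr q := fun q ↦ A.trPart_mem _
  rw [← covAlong_add nabla
    (h1.left_of_isCompl A.isSmoothSubbundle_tangentSub A.isSmoothSubbundle_tr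
      (fun q ↦ A.isCompl_tangentSub_tr q) hT hN)
    (h2.left_of_isCompl A.isSmoothSubbundle_tr A.isSmoothSubbundle_tangentSub
      (fun q ↦ (A.isCompl_tangentSub_tr q).symm) hN hT)]
  simp only [hsum]

theorem QGCR.IsCoScreen.noComponentLS {A : LightlikeSubmanifold E' g i r} {Q : A.QGCR c} (hQ : Q.IsCoScreen)
    {nabla : CovariantDerivative 𝓘(ℝ, E) E (TangentSpace 𝓘(ℝ, E) : N → Type _)}
    {μ : ℝ} (hμ : IsNearlySasakian c nabla μ) {X Y : ∀ p : M, TangentSpace 𝓘(ℝ, E') p}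
    (hX : SmoothField X) (hY : SmoothField Y) {p : M}
    (h : push i (A.inducedConn nabla X Y + A.inducedConn nabla Y X) p ∈ Q.D p) :
    Q.NoComponentLS p (A.transversalField nabla c X Y p) := by
  have hηX := hQ.η_eq_zero_of_mem_tangentSub (v := push i X p) ⟨_, rfl⟩
  have hηY := hQ.η_eq_zero_of_mem_tangentSub (v := push i Y p) ⟨_, rfl⟩
  have hT : A.transversalField nabla c X Y p
      = A.trPart p (covAlong nabla i (phiPush c i Y) p (X p)
        + covAlong nabla i (phiPush c i X) p (Y p)) := by
    rw [A.covAlong_phiPush nabla hX, A.trPart_add, A.trPart_add, transversalField, add_assoc]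
    rfl
  have hW : covAlong nabla i (push i Y) p (X p) + covAlong nabla i (push i X) p (Y p)
      = push i (A.inducedConn nabla X Y + A.inducedConn nabla Y X) p
        + (A.trPart p (covAlong nabla i (push i Y) p (X p))
          + A.trPart p (covAlong nabla i (push i X) p (Y p))) := by
    conv_lhs => rw [← A.tanPart_add_trPart (covAlong nabla i (push i Y) p (X p)),
      ← A.tanPart_add_trPart (covAlong nabla i (push i X) p (Y p))]
    rw [push, Pi.add_apply, map_add]
    unfold inducedConn
    abel
  -- With `η` zero on `X` and `Y`, only a multiple of `ξ` and `φ` of the symmetrized derivative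
  -- remain; by `h` the latter has its tangential part in `D`.
  rw [NoComponentLS, hT, hμ.covAlong (diffAlong_push A.smooth_i hX p)
    (diffAlong_push A.smooth_i hY p), hηX, hηY, zero_smul, zero_smul, sub_zero, sub_zero, smul_smul,
    A.trPart_add, A.trPart_of_mem_tr (Submodule.smul_mem _ _ hQ.ξ_mem_tr), hW]
  exact Submodule.add_mem_sup
    (hQ.trPart_φ_mem_G h (add_mem (A.trPart_mem _) (A.trPart_mem _)))
    (Submodule.smul_mem _ _ (Submodule.mem_span_singleton_self _))

end LightlikeSubmanifold

end Main

end Lightlike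

end

theorem mainTheorem4
    {E : Type*} [NormedAddCommGroup E] [NormedSpace ℝ E] [FiniteDimensional ℝ E]
    {N : Type*} [TopologicalSpace N] [T2Space N] [ChartedSpace E N] [IsManifold 𝓘(ℝ, E) ∞ N]
    {E' : Type*} [NormedAddCommGroup E'] [NormedSpace ℝ E'] [FiniteDimensional ℝ E']
    {M : Type*} [TopologicalSpace M] [T2Space M] [ChartedSpace E' M] [IsManifold 𝓘(ℝ, E') ∞ M]
    (g : Lightlike.SemiRiemannianMetric E N) (c : Lightlike.AlmostContactMetric g)
    (nabla : CovariantDerivative 𝓘(ℝ, E) E (TangentSpace 𝓘(ℝ, E) : N → Type _))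
    (hLC : Lightlike.IsLeviCivita g nabla)
    (μ : ℝ) (hμ : Lightlike.IsNearlySasakian c nabla μ)
    (i : M → N) (r : ℕ) (A : Lightlike.LightlikeSubmanifold E' g i r)
    (Q : A.QGCR c) (hQ : Q.IsCoScreen) :
    -- the transversal bundle splits as `(L ⊥ S) ⊥ G ⊥ ℝξ`
    (∀ p : M, Q.IsTransversalDecomposition p (Q.G p)) ∧
    -- and every splitting of this form with a `φ`-invariant third summand is this one
    (∀ (p : M) (G' : Submodule ℝ (TangentSpace 𝓘(ℝ, E) (i p))),
      Q.IsTransversalDecomposition p G' → c.phiImage G' = G' → G' = Q.G p) ∧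
    -- the claim for a single pair of fields, at a single point
    (∀ X Y : ∀ p : M, TangentSpace 𝓘(ℝ, E') p,
      Lightlike.SmoothField X → Lightlike.SmoothField Y →
      (∀ p, Lightlike.push i Y p ∈ Q.D p) →
      ∀ p : M,
        Lightlike.push i (A.inducedConn nabla X Y + A.inducedConn nabla Y X) p ∈ Q.D p →
        Q.NoComponentLS p (A.transversalField nabla c X Y p)) ∧
    -- the claim for nearly parallel `D`
    (A.NearlyParallel nabla Q.D →
      ∀ X Y : ∀ p : M, TangentSpace 𝓘(ℝ, E') p,
        Lightlike.SmoothField X → Lightlike.SmoothField Y →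
        (∀ p, Lightlike.push i Y p ∈ Q.D p) →
        ∀ p : M, Q.NoComponentLS p (A.transversalField nabla c X Y p)) := by
  refine ⟨hQ.isTransversalDecomposition, fun p G' h hφ ↦ hQ.eq_G_of_phiImage_eq h hφ,
    fun X Y hX hY _ p h ↦ hQ.noComponentLS hμ hX hY h,
    fun hD X Y hX hY hYD p ↦ hQ.noComponentLS hμ hX hY (hD X Y hX hY hYD p)⟩
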